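/- **Two-party model.** Let $\mathcal X$ be a finite set. Parties $A$ and $B$ hold $X\in\mathcal X^n$ and $Y\in\mathcal X^n$ and run a randomized protocol $P$: each party has private randomness, independent of that of the other party, and they alternately send messages, a finite number in total, each a function of the sender's input, the sender's private randomness and the previous messages. The view of a party is the tuple consisting of its input, its private randomness and the transcript of all messages. Datasets are neighbouring if they differ in a single coordinate. A randomized algorithm $M$ is $(\varepsilon,\delta)$-DP if $\Pr[M(D)\in S]\le e^{\varepsilon}\Pr[M(D')\in S]+\delta$ for all neighbouring $D,D'$ and all events $S$. The protocol $P$ is $(\varepsilon,\delta)$-two-party DP if, for every fixed $X$, the map $Y\mapsto \mathrm{VIEW}^A_P(X,Y)$ is $(\varepsilon,\delta)$-DP and, for every fixed $Y$, the map $X\mapsto\mathrm{VIEW}^B_P(X,Y)$ is $(\varepsilon,\delta)$-DP. It computes $f:\mathcal X^{2n}\to\mathbb R$ with error $\beta$ if one of the two parties can output, as a function of its view, a number that for all inputs $X,Y$ lies in $[f(X,Y)-\beta,f(X,Y)+\beta]$ with probability at least $0.9$. The global sensitivity of $f$ is the supremum of $|f(D)-f(D')|$ over neighbouring $D,D'\in\mathcal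 X^{2n}$. **Theorem.** Let $\varepsilon_0\ge 0$. (1) There are constants $c_1,c_2>0$ and $N$, depending only on $\varepsilon_0$, such that for every $n\ge N$ there is a function $f:\{0,1\}^{2n}\to\mathbb R$ of global sensitivity exactly $1$, of the form $$f(x_1,\dots,x_n,y_1,\dots,y_n)=\sum_{i=1}^{\lfloor n/D\rfloor}\Bigl(\sum_{\ell=1}^{D}x_{(i-1)D+\ell}\,y_{(i-1)D+\ell}\bmod 2\Bigr)$$ for some integer $D\ge1$ (the outer sum is over the integers), such that for all $0\le\varepsilon\le\varepsilon_0$ and $0\le\delta\le c_1/n$, no $(\varepsilon,\delta)$-two-party DP protocol computes $f$ with error at most $c_2\,n/\log n$. In particular, no $(\varepsilon,o(1/n))$-two-party DP protocol with $\varepsilon=O(1)$ computes $f$ within error $o(n/\log n)$. (2) The same holds for symmetric functions over a larger domain: there are constants $c_1,c_2>0$ and $N$, depending only on $\varepsilon_0$, such that for every $n\ge N$ there is a function $f:[2n]^{2n}\to\mathbb R$ that is symmetric (invariant under all permutations of its $2n$ arguments) and has global sensitivity exactly $1$, such that for all $0\le\varepsilon\le\varepsilon_0$ and $0\le\delta\le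 c_1/n$, no $(\varepsilon,\delta)$-two-party DP protocol computes $f$ with error at most $c_2\,n/\log n$. -/

import Mathlib

open MeasureTheory

namespace TwoPartyDP

/-- Two datasets are neighbouring if they differ in (at most) one coordinate. -/
def Neighbouring {ι 𝒳 : Type} (D D' : ι → 𝒳) : Prop :=
  ∃ i, ∀ j, j ≠ i → D j = D' j

/-- The global sensitivity of `f` is `s`: the supremum of `|f D - f D'|` over all pairs of
neighbouring datasets exists and equals `s`. -/
def HasSensitivity {ι 𝒳 : Type} (f : (ι → 𝒳) → ℝ) (s : ℝ) : Prop :=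
  IsLUB {d : ℝ | ∃ D D' : ι → 𝒳, Neighbouring D D' ∧ d = |f D - f D'|} s

/-- `f` is symmetric: it is invariant under every permutation of its arguments. -/
def IsSymmetric {ι 𝒳 : Type} (f : (ι → 𝒳) → ℝ) : Prop :=
  ∀ (σ : Equiv.Perm ι) (w : ι → 𝒳), f (w ∘ σ) = f w

/-- The randomized algorithm `M`, with random seed distributed according to `μ`, is
`(ε, δ)`-differentially private. -/
def IsDP {ι 𝒳 Ω Z : Type} [MeasurableSpace Ω] [MeasurableSpace Z] (μ : Measure Ω)
    (M : (ι → 𝒳) → Ω → Z) (ε δ : ℝ) : Prop :=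
  ∀ D D' : ι → 𝒳, Neighbouring D D' → ∀ S : Set Z, MeasurableSet S →
    μ.real {ω | M D ω ∈ S} ≤ Real.exp ε * μ.real {ω | M D' ω ∈ S} + δ

/-- A randomized two-party protocol in which each party holds `n` elements of `𝒳`.
Each party has private randomness (an arbitrary standard Borel probability space). The parties
alternately send a message from the message space `Msg` (an arbitrary standard Borel space), for
`rounds` messages in total; the message number `k` is a measurable function of the
input and the private randomness of its sender and of the `k` earlier messages. Party `A` sends the
messages number `0, 2, 4, …` and party `B` sends the messages number `1, 3, 5, …`. -/
structure Protocol (𝒳 : Type) (n : ℕ) where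
  CoinsA : Type
  CoinsB : Type
  Msg : Type
  [measurableSpaceA : MeasurableSpace CoinsA]
  [measurableSpaceB : MeasurableSpace CoinsB]
  [measurableSpaceMsg : MeasurableSpace Msg]
  [standardBorelA : StandardBorelSpace CoinsA]
  [standardBorelB : StandardBorelSpace CoinsB]
  [standardBorelMsg : StandardBorelSpace Msg]
  lawA : Measure CoinsA
  lawB : Measure CoinsB
  [isProbabilityMeasureA : IsProbabilityMeasure lawA]
  [isProbabilityMeasureB : IsProbabilityMeasure lawB]
  rounds : ℕ
  sendA : (k : ℕ) → (Fin n → 𝒳) → CoinsA → (Fin k → Msg) → Msg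
  sendB : (k : ℕ) → (Fin n → 𝒳) → CoinsB → (Fin k → Msg) → Msg
  measurable_sendA : ∀ k X, Measurable fun p : CoinsA × (Fin k → Msg) => sendA k X p.1 p.2
  measurable_sendB : ∀ k Y, Measurable fun p : CoinsB × (Fin k → Msg) => sendB k Y p.1 p.2

attribute [instance] Protocol.measurableSpaceA Protocol.measurableSpaceB
  Protocol.measurableSpaceMsg Protocol.standardBorelA Protocol.standardBorelB
  Protocol.standardBorelMsg Protocol.isProbabilityMeasureA Protocol.isProbabilityMeasureB

namespace Protocol

variable {𝒳 : Type} {n : ℕ} (P : Protocol 𝒳 n)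

/-- The private randomness of both parties together. -/
abbrev Coins : Type := P.CoinsA × P.CoinsB

/-- The private random seeds of the two parties are independent. -/
noncomputable def law : Measure P.Coins := P.lawA.prod P.lawB

/-- The first `k` messages on the inputs `X`, `Y` and the private random seeds `r`. -/
def messages (X Y : Fin n → 𝒳) (r : P.Coins) : (k : ℕ) → (Fin k → P.Msg)
  | 0 => Fin.elim0
  | k + 1 => Fin.snoc (α := fun _ => P.Msg) (messages X Y r k)
      (if Even k then P.sendA k X r.1 (messages X Y r k)
        else P.sendB k Y r.2 (messages X Y r k))

/-- The transcript: all messages of the protocol. -/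
def transcript (X Y : Fin n → 𝒳) (r : P.Coins) : Fin P.rounds → P.Msg :=
  P.messages X Y r P.rounds

/-- What `A` sees: its input, its private randomness, and the transcript. -/
abbrev ViewA : Type := (Fin n → 𝒳) × P.CoinsA × (Fin P.rounds → P.Msg)

/-- What `B` sees: its input, its private randomness, and the transcript. -/
abbrev ViewB : Type := (Fin n → 𝒳) × P.CoinsB × (Fin P.rounds → P.Msg)

/-- The view of `A` when the inputs are `X` and `Y`. -/
def viewA (X Y : Fin n → 𝒳) (r : P.Coins) : P.ViewA := (X, r.1, P.transcript X Y r)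

/-- The view of `B` when the inputs are `X` and `Y`. -/
def viewB (X Y : Fin n → 𝒳) (r : P.Coins) : P.ViewB := (Y, r.2, P.transcript X Y r)

/-- `P` is an `(ε, δ)`-two-party DP protocol: for every input `X` of `A`, the view of `A` is an
`(ε, δ)`-DP function of the input of `B`, and vice versa. -/
def IsTwoPartyDP [MeasurableSpace 𝒳] (ε δ : ℝ) : Prop :=
  (∀ X : Fin n → 𝒳, IsDP P.law (fun Y r => P.viewA X Y r) ε δ) ∧
  (∀ Y : Fin n → 𝒳, IsDP P.law (fun X r => P.viewB X Y r) ε δ)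

/-- `P` computes `f : 𝒳 ^ (2 n) → ℝ` with error `β`: one of the two parties can output, as a
function of its view, a number that on all inputs `X`, `Y` lies within `β` of `f (X, Y)` with
probability at least `0.9`. -/
def Computes [MeasurableSpace 𝒳] (f : (Fin (n + n) → 𝒳) → ℝ) (β : ℝ) : Prop :=
  (∃ out : P.ViewA → ℝ, Measurable out ∧ ∀ X Y : Fin n → 𝒳,
    0.9 ≤ P.law.real {r | |out (P.viewA X Y r) - f (Fin.append X Y)| ≤ β}) ∨
  (∃ out : P.ViewB → ℝ, Measurable out ∧ ∀ X Y : Fin n → 𝒳,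
    0.9 ≤ P.law.real {r | |out (P.viewB X Y r) - f (Fin.append X Y)| ≤ β})

end Protocol

/-- The sum of blockwise inner products modulo 2, with block length `D`: the first and the second
half of the `2 n` input bits `w = (x, y)` are cut into `⌊n / D⌋` consecutive blocks of length `D`
(the remaining bits are ignored), and the value is the sum over the blocks of the inner product
modulo 2 of the block of `x` and the block of `y`, each being `0` or `1`. -/
noncomputable def blockInnerProduct (n D : ℕ) (w : Fin (n + n) → Bool) : ℝ :=
  ∑ i ∈ Finset.range (n / D),
    (((∑ k ∈ (Finset.univ : Finset (Fin n)).filter (fun k : Fin n => (k : ℕ) / D = i),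
      (w (Fin.castAdd n k) && w (Fin.natAdd n k)).toNat) % 2 : ℕ) : ℝ)

end TwoPartyDP

/-! Why no private protocol does well. Let the inputs be uniform and independent. Each message
depends only on its sender's seed and the earlier messages, so the seeds stay conditionally
independent given the transcript. Privacy says that the transcript hardly distinguishes an input
from the same input with one bit flipped. Hence, given a typical transcript, each party's input is
semi-random: up to a small defect, every bit has conditional odds within a factor depending only on
`ε₀`, even when the other bits are known.

Vazirani's theorem says that the inner product modulo 2 of two independent semi-random sources of
length `D` has bias at most `θ ^ D` for some `θ < 1`. It is used here in a strong form, in which one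
of the two sources is known completely, because the output may depend on a whole view and not only
on the transcript. The part of `δ` that is lost adds `8 * D * δ`. So a view reveals at most `η = θ ^
D + 8 * D * δ` about the inner product of one block, whatever is fixed in the other blocks
(`abs_sum_ipSign_viewA_le` and `abs_sum_ipSign_viewB_le`, resting on `sum_mul_abs_fourier_le` and
`Screens.abs_sum_ipSign_mul_le`).

A hybrid argument changes the blocks one at a time from inner product 0 to inner product 1. All `n /
D` changes together move the probability of any event in a view by at most `8 * (n / D) * η`
(`accept_gap_le`). For `D` a large multiple of `log n` and `δ` at most a small multiple of `1 / n`
this is below `0.8`. The function, however, moves from 0 to its maximum `n / D`, and an output with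
error below half of this range would separate the two ends with probabilities at least `0.9` and at
most `0.1`.

For the symmetric function, bit `b` at position `k` becomes the symbol `2 * k + b`. Both parties
hold 1 at position `k` exactly when `2 * k + 1` occurs twice, and occurrence counts do not see the
order. Replacing one symbol changes two counts, so the function is halved to have sensitivity 1. -/

namespace TwoPartyDP

/-! ### Fourier bound for the inner product of two balanced sources -/

/-- The cube `{0, 1} ^ D`. -/
abbrev Cube (D : ℕ) : Type := Fin D → Bool

/-- The point of the cube with coordinate `j` flipped. -/
def flipAt {D : ℕ} (j : Fin D) (x : Cube D) : Cube D := Function.update x j (!x j)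

/-- The sign `(-1) ^ ⟨x, y⟩`. -/
def ipSign {D : ℕ} (x y : Cube D) : ℝ := ∏ i, if x i && y i then -1 else 1

/-- The Fourier transform of a function on the cube. -/
def fourier {D : ℕ} (b : Cube D → ℝ) (x : Cube D) : ℝ := ∑ y, ipSign x y * b y

/-- The total amount by which `a` violates the bound `a x ≤ E * a x'` for adjacent `x`, `x'`. -/
def ratioDefect (E : ℝ) {D : ℕ} (a : Cube D → ℝ) : ℝ :=
  ∑ j, ∑ x, max 0 (a x - E * a (flipAt j x))

open Classical in
/-- The indicator that `u` and `v` are within a factor `G` of each other. -/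
noncomputable def balanced (G u v : ℝ) : ℝ := if u ≤ G * v ∧ v ≤ G * u then 1 else 0

/-- The indicator of the points of the cube where each coordinate is balanced under `a`, given the
later coordinates. -/
noncomputable def suffixBalanced (G : ℝ) : (D : ℕ) → (Cube D → ℝ) → Cube D → ℝ
  | 0, _, _ => 1
  | D + 1, a, x =>
    balanced G (a (Fin.cons false (Fin.tail x))) (a (Fin.cons true (Fin.tail x))) *
      suffixBalanced G D (fun z => a (Fin.cons false z) + a (Fin.cons true z)) (Fin.tail x)

/-- The indicator of the points of the cube where each coordinate is balanced under `b`, given the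
earlier coordinates. -/
noncomputable def prefixBalanced (G : ℝ) : (D : ℕ) → (Cube D → ℝ) → Cube D → ℝ
  | 0, _, _ => 1
  | D + 1, b, y =>
    balanced G (∑ z, b (Fin.cons false z)) (∑ z, b (Fin.cons true z)) *
      prefixBalanced G D (fun z => b (Fin.cons (y 0) z)) (Fin.tail y)

lemma sum_cube_succ {D : ℕ} (g : Cube (D + 1) → ℝ) :
    ∑ x, g x = ∑ z : Cube D, g (Fin.cons false z) + ∑ z : Cube D, g (Fin.cons true z) := by
  rw [← (Fin.consEquiv (fun _ : Fin (D + 1) => Bool)).sum_comp g, Fintype.sum_prod_type]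
  simp [Fin.consEquiv, add_comm]

lemma ipSign_cons {D : ℕ} (c d : Bool) (x y : Cube D) :
    ipSign (Fin.cons c x : Cube (D + 1)) (Fin.cons d y) =
      (if c && d then -1 else 1) * ipSign x y := by
  simp [ipSign, Fin.prod_univ_succ]

lemma ipSign_comm {D : ℕ} (x y : Cube D) : ipSign x y = ipSign y x := by
  simp [ipSign, and_comm]

lemma abs_ipSign {D : ℕ} (x y : Cube D) : |ipSign x y| = 1 := by
  rw [ipSign, Finset.abs_prod]
  refine Finset.prod_eq_one fun i _ => ?_
  split_ifs <;> simp

lemma balanced_nonneg (G u v : ℝ) : 0 ≤ balanced G u v := by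
  unfold balanced; split_ifs <;> simp

lemma balanced_le_one (G u v : ℝ) : balanced G u v ≤ 1 := by
  unfold balanced; split_ifs <;> simp

lemma suffixBalanced_mem (G : ℝ) : ∀ (D : ℕ) (a : Cube D → ℝ) (x : Cube D),
    0 ≤ suffixBalanced G D a x ∧ suffixBalanced G D a x ≤ 1
  | 0, _, _ => by simp [suffixBalanced]
  | D + 1, a, x => by
    have h := suffixBalanced_mem G D (fun z => a (Fin.cons false z) + a (Fin.cons true z))
      (Fin.tail x)
    exact ⟨mul_nonneg (balanced_nonneg _ _ _) h.1,
      mul_le_one₀ (balanced_le_one _ _ _) h.1 h.2⟩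

lemma prefixBalanced_mem (G : ℝ) : ∀ (D : ℕ) (b : Cube D → ℝ) (y : Cube D),
    0 ≤ prefixBalanced G D b y ∧ prefixBalanced G D b y ≤ 1
  | 0, _, _ => by simp [prefixBalanced]
  | D + 1, b, y => by
    have h := prefixBalanced_mem G D (fun z => b (Fin.cons (y 0) z)) (Fin.tail y)
    exact ⟨mul_nonneg (balanced_nonneg _ _ _) h.1,
      mul_le_one₀ (balanced_le_one _ _ _) h.1 h.2⟩

/-- The contraction factor of one coordinate. -/
noncomputable def contraction (G : ℝ) : ℝ := 1 - 4 * G / (G + 1) ^ 3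

lemma contraction_nonneg {G : ℝ} (hG : 1 ≤ G) : 0 ≤ contraction G := by
  rw [contraction, sub_nonneg, div_le_one (by positivity)]
  nlinarith [sq_nonneg (G - 1), sq_nonneg G]

lemma contraction_lt_one {G : ℝ} (hG : 1 ≤ G) : contraction G < 1 := by
  have : 0 < 4 * G / (G + 1) ^ 3 := by positivity
  rw [contraction]; linarith

lemma fourier_cons {D : ℕ} (b : Cube (D + 1) → ℝ) (c : Bool) (x : Cube D) :
    fourier b (Fin.cons c x) = fourier (fun z => b (Fin.cons false z)) x +
      (if c then -1 else 1) * fourier (fun z => b (Fin.cons true z)) x := by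
  simp only [fourier, sum_cube_succ, ipSign_cons, Finset.mul_sum]
  cases c <;> simp

lemma fourier_const_mul {D : ℕ} (t : ℝ) (b : Cube D → ℝ) (x : Cube D) :
    fourier (fun z => t * b z) x = t * fourier b x := by
  simp only [fourier, Finset.mul_sum]
  exact Finset.sum_congr rfl fun _ _ => by ring

/-- Expanding the squares leaves the cross term `2 * (u - v) * p * q`, and balance gives `|u - v| ≤
(G - 1) / (G + 1) * (u + v)`. This is the use of the balance of the first source. -/
lemma two_point_bound {G u v p q : ℝ} (hG : 1 ≤ G) (hu : 0 ≤ u) (hv : 0 ≤ v) :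
    balanced G u v * (u * (p + q) ^ 2 + v * (p - q) ^ 2) ≤
      (u + v) * (p ^ 2 + q ^ 2 + 2 * ((G - 1) / (G + 1)) * |p * q|) := by
  have hG1 : 0 < G + 1 := by linarith
  have hρ : 0 ≤ (G - 1) / (G + 1) := div_nonneg (by linarith) hG1.le
  unfold balanced
  split_ifs with h
  · obtain ⟨h1, h2⟩ := h
    have key : |u - v| ≤ (G - 1) / (G + 1) * (u + v) := by
      rw [div_mul_eq_mul_div, le_div_iff₀ hG1]
      cases abs_cases (u - v) <;> nlinarith
    have : (u - v) * (p * q) ≤ (G - 1) / (G + 1) * (u + v) * |p * q| :=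
      (le_abs_self _).trans (by rw [abs_mul]; gcongr)
    nlinarith
  · rw [zero_mul]; positivity

/-- The left side falls short of `(u + v) ^ 2` by `4 / (G + 1) * u * v`, and balance forces `u * v ≥
G / (G + 1) ^ 2 * (u + v) ^ 2`. This is the use of the balance of the second source, and the source
of the value of `contraction`. -/
lemma balanced_sq_bound {G u v : ℝ} (hG : 1 ≤ G) :
    balanced G u v * (u ^ 2 + v ^ 2 + 2 * ((G - 1) / (G + 1)) * (u * v)) ≤
      contraction G * (u + v) ^ 2 := by
  have hG1 : 0 < G + 1 := by linarith
  unfold balanced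
  split_ifs with h
  · obtain ⟨h1, h2⟩ := h
    have key : G / (G + 1) ^ 2 * (u + v) ^ 2 ≤ u * v := by
      rw [div_mul_eq_mul_div, div_le_iff₀ (by positivity)]
      nlinarith [mul_nonneg (sub_nonneg.2 h1) (sub_nonneg.2 h2)]
    have e1 : (G - 1) / (G + 1) = 1 - 2 / (G + 1) := by field_simp; ring
    have e2 : contraction G = 1 - 4 / (G + 1) * (G / (G + 1) ^ 2) := by
      rw [contraction]; field_simp
    have : 4 / (G + 1) * (G / (G + 1) ^ 2 * (u + v) ^ 2) ≤ 4 / (G + 1) * (u * v) := by gcongr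
    rw [e1, e2]
    have e3 : 4 / (G + 1) = 2 * (2 / (G + 1)) := by ring
    rw [e3] at this ⊢
    nlinarith
  · rw [zero_mul]; exact mul_nonneg (contraction_nonneg hG) (sq_nonneg _)

/-- Vazirani's bound on the inner product of two semi-random sources. -/
lemma sum_fourier_sq_le {G : ℝ} (hG : 1 ≤ G) : ∀ (D : ℕ) (a b : Cube D → ℝ),
    (∀ x, 0 ≤ a x) → (∀ y, 0 ≤ b y) →
    ∑ x, suffixBalanced G D a x * a x * fourier (fun y => prefixBalanced G D b y * b y) x ^ 2 ≤
      contraction G ^ D * ((∑ x, a x) * (∑ y, b y) ^ 2)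
  | 0, a, b, _, _ => by
    simp [suffixBalanced, prefixBalanced, fourier, ipSign]
  | D + 1, a, b, ha, hb => by
    -- Removing coordinate 0 merges `a` over it but splits `b` into two branches. This is why `a`
    -- must be balanced given the later coordinates and `b` given the earlier ones.
    set a' : Cube D → ℝ := fun z => a (Fin.cons false z) + a (Fin.cons true z) with ha'
    set b₀ : Cube D → ℝ := fun z => b (Fin.cons false z) with hb₀
    set b₁ : Cube D → ℝ := fun z => b (Fin.cons true z) with hb₁
    set p := fourier (fun y => prefixBalanced G D b₀ y * b₀ y) with hp
    set q := fourier (fun y => prefixBalanced G D b₁ y * b₁ y) with hq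
    set t := balanced G (∑ z, b₀ z) (∑ z, b₁ z) with ht
    have ha'0 : ∀ z, 0 ≤ a' z := fun z => add_nonneg (ha _) (ha _)
    have hB0 : 0 ≤ ∑ z, b₀ z := Finset.sum_nonneg fun z _ => hb _
    have hB1 : 0 ≤ ∑ z, b₁ z := Finset.sum_nonneg fun z _ => hb _
    have hA : 0 ≤ ∑ z, a' z := Finset.sum_nonneg fun z _ => ha'0 _
    have hρ : 0 ≤ (G - 1) / (G + 1) := div_nonneg (by linarith) (by linarith)
    have hc := contraction_nonneg hG
    have ih0 := sum_fourier_sq_le hG D a' b₀ ha'0 (fun z => hb _)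
    have ih1 := sum_fourier_sq_le hG D a' b₁ ha'0 (fun z => hb _)
    set w : Cube D → ℝ := fun z => suffixBalanced G D a' z * a' z with hw
    have hw0 : ∀ z, 0 ≤ w z := fun z => mul_nonneg (suffixBalanced_mem G D a' z).1 (ha'0 z)
    -- The mixed term follows from the two square terms by Cauchy–Schwarz; the induction hypotheses
    -- have exactly the product form that this needs.
    have ih01 : ∑ z, w z * |p z * q z| ≤
        contraction G ^ D * ((∑ x, a' x) * ((∑ z, b₀ z) * ∑ z, b₁ z)) := by
      refine abs_le_of_sq_le_sq' ?_ (by positivity) |>.2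
      refine (Finset.sum_sq_le_sum_mul_sum_of_sq_le_mul Finset.univ
        (f := fun z => w z * p z ^ 2) (g := fun z => w z * q z ^ 2)
        (fun z _ => mul_nonneg (hw0 z) (sq_nonneg _))
        (fun z _ => mul_nonneg (hw0 z) (sq_nonneg _))
        (fun z _ => le_of_eq (by rw [mul_pow, sq_abs]; ring))).trans ?_
      refine (mul_le_mul ih0 ih1 (Finset.sum_nonneg fun z _ =>
        mul_nonneg (hw0 z) (sq_nonneg _)) (by positivity)).trans (le_of_eq (by ring))
    have hF : ∀ (c : Bool) (z : Cube D),
        fourier (fun y => prefixBalanced G (D + 1) b y * b y) (Fin.cons c z) =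
          t * (p z + (if c then -1 else 1) * q z) := by
      intro c z
      rw [fourier_cons]
      simp only [prefixBalanced, Fin.cons_zero, Fin.tail_cons, mul_assoc, fourier_const_mul]
      rw [hp, hq, ht, hb₀, hb₁]
      ring
    -- The indicator `t` comes out of the square of the transform; a single factor of it is kept
    -- until `balanced_sq_bound` consumes it.
    have ht2 : t ^ 2 = t := by
      rw [ht]; unfold balanced; split_ifs <;> simp
    calc _ = t * ∑ z, suffixBalanced G D a' z *
          (balanced G (a (Fin.cons false z)) (a (Fin.cons true z)) *
          (a (Fin.cons false z) * (p z + q z) ^ 2 + a (Fin.cons true z) * (p z - q z) ^ 2)) := by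
          rw [sum_cube_succ, ← Finset.sum_add_distrib, Finset.mul_sum]
          refine Finset.sum_congr rfl fun z _ => ?_
          rw [hF, hF]
          simp only [suffixBalanced, Fin.tail_cons, mul_pow, ht2]
          simp only [Bool.false_eq_true, if_false, if_true]
          ring
      _ ≤ t * ∑ z, suffixBalanced G D a' z * (a' z *
          (p z ^ 2 + q z ^ 2 + 2 * ((G - 1) / (G + 1)) * |p z * q z|)) := by
          refine mul_le_mul_of_nonneg_left (Finset.sum_le_sum fun z _ => ?_)
            (balanced_nonneg _ _ _)
          exact mul_le_mul_of_nonneg_left (two_point_bound hG (ha _) (ha _))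
            (suffixBalanced_mem G D a' z).1
      _ = t * (∑ z, w z * p z ^ 2 + ∑ z, w z * q z ^ 2 +
            2 * ((G - 1) / (G + 1)) * ∑ z, w z * |p z * q z|) := by
          rw [Finset.mul_sum (a := 2 * ((G - 1) / (G + 1))), ← Finset.sum_add_distrib,
            ← Finset.sum_add_distrib]
          congr 1
          exact Finset.sum_congr rfl fun z _ => by rw [hw]; ring
      _ ≤ t * (contraction G ^ D * ((∑ x, a' x) * (∑ z, b₀ z) ^ 2) +
            contraction G ^ D * ((∑ x, a' x) * (∑ z, b₁ z) ^ 2) + 2 * ((G - 1) / (G + 1)) *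
            (contraction G ^ D * ((∑ x, a' x) * ((∑ z, b₀ z) * ∑ z, b₁ z)))) := by
          refine mul_le_mul_of_nonneg_left ?_ (balanced_nonneg _ _ _)
          gcongr
      _ = contraction G ^ D * (∑ x, a' x) * (t * ((∑ z, b₀ z) ^ 2 + (∑ z, b₁ z) ^ 2 +
            2 * ((G - 1) / (G + 1)) * ((∑ z, b₀ z) * ∑ z, b₁ z))) := by ring
      _ ≤ contraction G ^ D * (∑ x, a' x) *
            (contraction G * (∑ z, b₀ z + ∑ z, b₁ z) ^ 2) := by
          refine mul_le_mul_of_nonneg_left (balanced_sq_bound hG) (by positivity)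
      _ = _ := by
          rw [sum_cube_succ, sum_cube_succ, ha', Finset.sum_add_distrib]
          ring

/-! ### Sources that are balanced only up to a defect -/

lemma flipAt_cons_zero {D : ℕ} (c : Bool) (z : Cube D) :
    flipAt 0 (Fin.cons c z : Cube (D + 1)) = Fin.cons (!c) z := by
  simp [flipAt, Fin.update_cons_zero]

lemma flipAt_cons_succ {D : ℕ} (c : Bool) (j : Fin D) (z : Cube D) :
    flipAt j.succ (Fin.cons c z : Cube (D + 1)) = Fin.cons c (flipAt j z) := by
  simp [flipAt, Fin.cons_update]

lemma ratioDefect_succ {E : ℝ} {D : ℕ} (a : Cube (D + 1) → ℝ) :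
    ratioDefect E a =
      ∑ z : Cube D, (max 0 (a (Fin.cons false z) - E * a (Fin.cons true z)) +
        max 0 (a (Fin.cons true z) - E * a (Fin.cons false z))) +
      (ratioDefect E (fun z => a (Fin.cons false z)) +
        ratioDefect E (fun z => a (Fin.cons true z))) := by
  simp only [ratioDefect, Fin.sum_univ_succ, sum_cube_succ, flipAt_cons_zero, flipAt_cons_succ,
    Finset.sum_add_distrib, Bool.not_false, Bool.not_true]
  ring

/-- Needed to pass to the marginal when coordinate 0 of a source is merged. -/
lemma ratioDefect_add_le {E : ℝ} {D : ℕ} (a b : Cube D → ℝ) :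
    ratioDefect E (fun z => a z + b z) ≤ ratioDefect E a + ratioDefect E b := by
  simp only [ratioDefect, ← Finset.sum_add_distrib]
  refine Finset.sum_le_sum fun j _ => Finset.sum_le_sum fun x _ => ?_
  refine max_le (add_nonneg (le_max_left _ _) (le_max_left _ _)) ?_
  have h1 := le_max_right 0 (a x - E * a (flipAt j x))
  have h2 := le_max_right 0 (b x - E * b (flipAt j x))
  linarith

/-- The doubled ratio is slack: if `u > 2 * E * v`, then `u - E * v > u / 2`, so the violation of
the ratio `E` already pays for a constant fraction of the mass `u + v`. -/
lemma one_sub_balanced_mul_le {E u v : ℝ} (hE : 1 ≤ E) (hu : 0 ≤ u) (hv : 0 ≤ v) :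
    (1 - balanced (2 * E) u v) * (u + v) ≤ 4 * (max 0 (u - E * v) + max 0 (v - E * u)) := by
  have h1 := le_max_right 0 (u - E * v)
  have h2 := le_max_right 0 (v - E * u)
  have h3 := le_max_left 0 (u - E * v)
  have h4 := le_max_left 0 (v - E * u)
  unfold balanced
  split_ifs with h
  · rw [sub_self, zero_mul]; positivity
  · rw [not_and_or, not_le, not_le] at h
    rcases h with h | h <;> nlinarith

/-- Union bound over coordinates, from `1 - s * t ≤ (1 - s) + (1 - t)` on `[0, 1]`. Coordinate 0 is
paid for by its own part of the defect, the rest by the defect of the marginal. -/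
lemma sum_one_sub_suffixBalanced_le {E : ℝ} (hE : 1 ≤ E) : ∀ (D : ℕ) (a : Cube D → ℝ),
    (∀ x, 0 ≤ a x) → ∑ x, (1 - suffixBalanced (2 * E) D a x) * a x ≤ 4 * ratioDefect E a
  | 0, a, _ => by simp [suffixBalanced, ratioDefect]
  | D + 1, a, ha => by
    set a' : Cube D → ℝ := fun z => a (Fin.cons false z) + a (Fin.cons true z) with ha'
    have ih := sum_one_sub_suffixBalanced_le hE D a' (fun z => add_nonneg (ha _) (ha _))
    have hadd := ratioDefect_add_le (E := E) (fun z : Cube D => a (Fin.cons false z))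
      (fun z => a (Fin.cons true z))
    rw [ratioDefect_succ, sum_cube_succ, ← Finset.sum_add_distrib]
    simp only [suffixBalanced, Fin.tail_cons]
    calc _ ≤ ∑ z, (4 * (max 0 (a (Fin.cons false z) - E * a (Fin.cons true z)) +
        max 0 (a (Fin.cons true z) - E * a (Fin.cons false z))) +
        (1 - suffixBalanced (2 * E) D a' z) * a' z) := by
          refine Finset.sum_le_sum fun z _ => ?_
          have h1 := one_sub_balanced_mul_le hE (ha (Fin.cons false z)) (ha (Fin.cons true z))
          have h2 := suffixBalanced_mem (2 * E) D a' z
          have h3 := balanced_le_one (2 * E) (a (Fin.cons false z)) (a (Fin.cons true z))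
          have h4 : 0 ≤ a' z := add_nonneg (ha _) (ha _)
          have h5 : 0 ≤ (1 - balanced (2 * E) (a (Fin.cons false z)) (a (Fin.cons true z))) *
            (1 - suffixBalanced (2 * E) D a' z) * a' z :=
            mul_nonneg (mul_nonneg (by linarith) (by linarith)) h4
          simp only [ha'] at h1 h2 h5 ⊢
          nlinarith
      _ ≤ _ := by
          rw [Finset.sum_add_distrib, ← Finset.mul_sum]
          linarith

lemma sum_one_sub_prefixBalanced_le {E : ℝ} (hE : 1 ≤ E) : ∀ (D : ℕ) (b : Cube D → ℝ),
    (∀ x, 0 ≤ b x) → ∑ x, (1 - prefixBalanced (2 * E) D b x) * b x ≤ 4 * ratioDefect E b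
  | 0, b, _ => by simp [prefixBalanced, ratioDefect]
  | D + 1, b, hb => by
    set b₀ : Cube D → ℝ := fun z => b (Fin.cons false z) with hb₀
    set b₁ : Cube D → ℝ := fun z => b (Fin.cons true z) with hb₁
    have ih0 := sum_one_sub_prefixBalanced_le hE D b₀ (fun z => hb _)
    have ih1 := sum_one_sub_prefixBalanced_le hE D b₁ (fun z => hb _)
    set t := balanced (2 * E) (∑ z, b₀ z) (∑ z, b₁ z) with ht
    have ht1 : t ≤ 1 := balanced_le_one _ _ _
    have hB0 : 0 ≤ ∑ z, b₀ z := Finset.sum_nonneg fun z _ => hb _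
    have hB1 : 0 ≤ ∑ z, b₁ z := Finset.sum_nonneg fun z _ => hb _
    have hroot := one_sub_balanced_mul_le hE hB0 hB1
    -- Here balance of coordinate 0 concerns the total masses of the branches. The positive part is
    -- subadditive, so their violation is at most the sum of the pointwise ones.
    have hmax : ∀ u v : Cube D → ℝ, max 0 (∑ z, u z - E * ∑ z, v z) ≤
        ∑ z, max 0 (u z - E * v z) := by
      intro u v
      refine max_le (Finset.sum_nonneg fun _ _ => le_max_left _ _) ?_
      rw [Finset.mul_sum, ← Finset.sum_sub_distrib]
      exact Finset.sum_le_sum fun _ _ => le_max_right _ _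
    have key : ∀ u : Cube D → ℝ, (∀ z, 0 ≤ u z) →
        ∑ z, (1 - t * prefixBalanced (2 * E) D u z) * u z ≤
          (1 - t) * ∑ z, u z + ∑ z, (1 - prefixBalanced (2 * E) D u z) * u z := by
      intro u hu
      rw [Finset.mul_sum, ← Finset.sum_add_distrib]
      refine Finset.sum_le_sum fun z _ => ?_
      have h2 := prefixBalanced_mem (2 * E) D u z
      have h5 : 0 ≤ (1 - t) * (1 - prefixBalanced (2 * E) D u z) * u z :=
        mul_nonneg (mul_nonneg (by linarith) (by linarith)) (hu z)
      nlinarith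
    have k0 := key b₀ (fun z => hb _)
    have k1 := key b₁ (fun z => hb _)
    have m0 := hmax b₀ b₁
    have m1 := hmax b₁ b₀
    rw [ratioDefect_succ, sum_cube_succ, Finset.sum_add_distrib]
    simp only [prefixBalanced, Fin.tail_cons, Fin.cons_zero]
    rw [← ht] at hroot
    linarith

lemma abs_fourier_le {D : ℕ} (b : Cube D → ℝ) (x : Cube D) : |fourier b x| ≤ ∑ y, |b y| := by
  refine (Finset.abs_sum_le_sum_abs _ _).trans (Finset.sum_le_sum fun y _ => ?_)
  rw [abs_mul, abs_ipSign, one_mul]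

/-- The inner product of two independent sources that are semi-random up to small defects is
nearly unbiased, even given the first source. -/
lemma sum_mul_abs_fourier_le {E : ℝ} (hE : 1 ≤ E) {D : ℕ} {a b : Cube D → ℝ}
    (ha : ∀ x, 0 ≤ a x) (hb : ∀ y, 0 ≤ b y) :
    ∑ x, a x * |fourier b x| ≤ √(contraction (2 * E)) ^ D * ((∑ x, a x) * ∑ y, b y) +
      4 * ((∑ y, b y) * ratioDefect E a + (∑ x, a x) * ratioDefect E b) := by
  have hG : (1 : ℝ) ≤ 2 * E := by linarith
  set u := suffixBalanced (2 * E) D a with hu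
  set v := prefixBalanced (2 * E) D b with hv
  have hum : ∀ x, 0 ≤ u x ∧ u x ≤ 1 := suffixBalanced_mem (2 * E) D a
  have hvm : ∀ x, 0 ≤ v x ∧ v x ≤ 1 := prefixBalanced_mem (2 * E) D b
  have hA : 0 ≤ ∑ z, a z := Finset.sum_nonneg fun z _ => ha _
  have hB : 0 ≤ ∑ z, b z := Finset.sum_nonneg fun z _ => hb _
  have hbadA : ∑ x, (1 - u x) * a x ≤ 4 * ratioDefect E a :=
    sum_one_sub_suffixBalanced_le hE D a ha
  have hbadB : ∑ x, (1 - v x) * b x ≤ 4 * ratioDefect E b :=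
    sum_one_sub_prefixBalanced_le hE D b hb
  have hmain := sum_fourier_sq_le hG D a b ha hb
  set p := fourier (fun y => v y * b y) with hp
  -- Cauchy–Schwarz passes from the second moment of the transform to the first, which turns the
  -- contraction factor into its square root.
  have hcs : ∑ x, u x * a x * |p x| ≤
      √(contraction (2 * E)) ^ D * ((∑ x, a x) * ∑ y, b y) := by
    refine abs_le_of_sq_le_sq' ?_ (by positivity) |>.2
    refine (Finset.sum_sq_le_sum_mul_sum_of_sq_le_mul Finset.univ
      (f := fun x => u x * a x) (g := fun x => u x * a x * p x ^ 2)
      (fun z _ => mul_nonneg (hum z).1 (ha z))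
      (fun z _ => mul_nonneg (mul_nonneg (hum z).1 (ha z)) (sq_nonneg _))
      (fun z _ => le_of_eq (by rw [mul_pow, sq_abs]; ring))).trans ?_
    have h1 : ∑ x, u x * a x ≤ ∑ x, a x :=
      Finset.sum_le_sum fun x _ => mul_le_of_le_one_left (ha x) (hum x).2
    refine (mul_le_mul h1 hmain (Finset.sum_nonneg fun z _ =>
      mul_nonneg (mul_nonneg (hum z).1 (ha z)) (sq_nonneg _)) hA).trans (le_of_eq ?_)
    rw [mul_pow, ← pow_mul, mul_comm D 2, pow_mul, Real.sq_sqrt (contraction_nonneg hG)]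
    ring
  have hp_le : ∀ x, |p x| ≤ ∑ y, b y := fun x => (abs_fourier_le _ x).trans <|
    Finset.sum_le_sum fun y _ => by
      rw [abs_of_nonneg (mul_nonneg (hvm y).1 (hb y))]
      exact mul_le_of_le_one_left (hb y) (hvm y).2
  -- The discarded part of `b` changes each Fourier coefficient by at most its mass.
  have hdiff : ∀ x, |fourier b x| ≤ |p x| + 4 * ratioDefect E b := by
    intro x
    have e : fourier b x = p x + fourier (fun y => (1 - v y) * b y) x := by
      simp only [hp, fourier, ← Finset.sum_add_distrib]
      exact Finset.sum_congr rfl fun y _ => by ring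
    rw [e]
    refine (abs_add_le _ _).trans (add_le_add le_rfl ?_)
    refine ((abs_fourier_le _ x).trans (le_of_eq ?_)).trans hbadB
    refine Finset.sum_congr rfl fun y _ => abs_of_nonneg (mul_nonneg ?_ (hb y))
    linarith [(hvm y).2]
  calc ∑ x, a x * |fourier b x|
      ≤ ∑ x, (u x * a x * |p x| + (1 - u x) * a x * (∑ y, b y) +
          a x * (4 * ratioDefect E b)) := by
        refine Finset.sum_le_sum fun x _ => ?_
        have h1 := mul_le_mul_of_nonneg_left (hdiff x) (ha x)
        have h2 := mul_le_mul_of_nonneg_left (hp_le x)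
          (mul_nonneg (sub_nonneg.2 (hum x).2) (ha x))
        nlinarith
    _ = ∑ x, u x * a x * |p x| + (∑ x, (1 - u x) * a x) * (∑ y, b y) +
          (∑ x, a x) * (4 * ratioDefect E b) := by
        rw [Finset.sum_add_distrib, Finset.sum_add_distrib, Finset.sum_mul, Finset.sum_mul]
    _ ≤ _ := by
        have := mul_le_mul_of_nonneg_right hbadA hB
        linarith

/-! ### Conditional independence and the bias of the inner product -/

/-- The conditional probability of `s` given the sub-σ-algebra `m`. -/
noncomputable abbrev condProb {Ω : Type*} {mΩ : MeasurableSpace Ω} (μ : Measure Ω)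
    (m : MeasurableSpace Ω) (s : Set Ω) : Ω → ℝ := μ[s.indicator (fun _ => (1 : ℝ)) | m]

/-- Given `mF`, the σ-algebra `mA` carries no information on the events in `mB`. -/
def Screens {Ω : Type*} {mΩ : MeasurableSpace Ω} (μ : Measure Ω)
    (mF mA mB : MeasurableSpace Ω) : Prop :=
  ∀ B, MeasurableSet[mB] B → condProb μ (mA ⊔ mF) B =ᵐ[μ] condProb μ mF B

section

variable {Ω : Type*} {m mF mA mB mΩ : MeasurableSpace Ω} {μ : Measure Ω}

lemma integrable_indicator_one [IsProbabilityMeasure μ] {s : Set Ω} (hs : MeasurableSet s) :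
    Integrable (s.indicator (fun _ => (1 : ℝ))) μ :=
  (integrable_const 1).indicator hs

lemma condProb_nonneg (s : Set Ω) : 0 ≤ᵐ[μ] condProb μ m s :=
  condExp_nonneg (ae_of_all _ fun _ => Set.indicator_nonneg (fun _ _ => zero_le_one) _)

lemma setIntegral_eq_integral_indicator_mul {s : Set Ω} (hs : MeasurableSet s) (g : Ω → ℝ) :
    ∫ ω in s, g ω ∂μ = ∫ ω, s.indicator (fun _ => (1 : ℝ)) ω * g ω ∂μ := by
  rw [← integral_indicator hs]
  congr 1 with ω
  by_cases h : ω ∈ s <;> simp [h]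

lemma real_eq_integral_indicator {s : Set Ω} (hs : MeasurableSet s) :
    μ.real s = ∫ ω, s.indicator (fun _ => (1 : ℝ)) ω ∂μ := by
  rw [integral_indicator hs]; simp

variable [IsProbabilityMeasure μ]

lemma condProb_le_one (hm : m ≤ mΩ) {s : Set Ω} (hs : MeasurableSet s) :
    ∀ᵐ ω ∂μ, condProb μ m s ω ≤ 1 := by
  have h := condExp_mono (m := m) (integrable_indicator_one (μ := μ) hs) (integrable_const (1 : ℝ))
    (ae_of_all _ fun _ => Set.indicator_le_self' (fun _ _ => zero_le_one) _)
  filter_upwards [h] with ω hω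
  rwa [condExp_const hm] at hω

lemma norm_condProb_le_one (hm : m ≤ mΩ) {s : Set Ω} (hs : MeasurableSet s) :
    ∀ᵐ ω ∂μ, ‖condProb μ m s ω‖ ≤ 1 := by
  filter_upwards [condProb_nonneg (μ := μ) (m := m) s, condProb_le_one hm hs] with ω h0 h1
  rwa [Real.norm_of_nonneg h0]

lemma norm_indicator_one_le (s : Set Ω) (ω : Ω) : ‖s.indicator (fun _ => (1 : ℝ)) ω‖ ≤ 1 := by
  by_cases h : ω ∈ s <;> simp [h]

lemma integral_mul_condExp_of_bound (hm : m ≤ mΩ) {f g : Ω → ℝ} (hg : StronglyMeasurable[m] g)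
    {c : ℝ} (hc : ∀ᵐ ω ∂μ, ‖g ω‖ ≤ c) (hf : Integrable f μ) :
    ∫ ω, g ω * (μ[f | m]) ω ∂μ = ∫ ω, g ω * f ω ∂μ := by
  rw [← integral_condExp hm (f := fun ω => g ω * f ω)]
  exact integral_congr_ae (condExp_stronglyMeasurable_mul_of_bound hm hg hf c hc).symm

lemma sup_eq_generateFrom_inter (mA mF : MeasurableSpace Ω) :
    mA ⊔ mF = MeasurableSpace.generateFrom
      (Set.image2 (· ∩ ·) {s | MeasurableSet[mA] s} {s | MeasurableSet[mF] s}) := by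
  refine le_antisymm (sup_le ?_ ?_) (MeasurableSpace.generateFrom_le ?_)
  · exact fun s hs => MeasurableSpace.measurableSet_generateFrom
      ⟨s, hs, Set.univ, MeasurableSet.univ, Set.inter_univ s⟩
  · exact fun s hs => MeasurableSpace.measurableSet_generateFrom
      ⟨Set.univ, MeasurableSet.univ, s, hs, Set.univ_inter s⟩
  · rintro _ ⟨s, hs, t, ht, rfl⟩
    exact MeasurableSet.inter ((le_sup_left : mA ≤ mA ⊔ mF) s hs)
      ((le_sup_right : mF ≤ mA ⊔ mF) t ht)

lemma isPiSystem_image2_inter (mA mF : MeasurableSpace Ω) :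
    IsPiSystem (Set.image2 (· ∩ ·) {s | MeasurableSet[mA] s} {s | MeasurableSet[mF] s}) := by
  rintro _ ⟨s, hs, t, ht, rfl⟩ _ ⟨s', hs', t', ht', rfl⟩ _
  exact ⟨s ∩ s', @MeasurableSet.inter _ mA _ _ hs hs', t ∩ t',
    @MeasurableSet.inter _ mF _ _ ht ht', Set.inter_inter_inter_comm _ _ _ _⟩

/-- Under screening, the conditional probability given the screen computes the measures of
intersections. -/
lemma Screens.integral_mul_indicator (h : Screens μ mF mA mB) (hF : mF ≤ mΩ) (hA : mA ≤ mΩ)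
    (hB : mB ≤ mΩ) {B : Set Ω} (hBm : MeasurableSet[mB] B) {g : Ω → ℝ}
    (hg : StronglyMeasurable[mA ⊔ mF] g) {c : ℝ} (hc : ∀ᵐ ω ∂μ, ‖g ω‖ ≤ c) :
    ∫ ω, g ω * B.indicator (fun _ => (1 : ℝ)) ω ∂μ = ∫ ω, g ω * condProb μ mF B ω ∂μ := by
  rw [← integral_mul_condExp_of_bound (sup_le hA hF) hg hc (integrable_indicator_one (hB _ hBm))]
  refine integral_congr_ae ?_
  filter_upwards [h B hBm] with ω hω
  rw [← hω]

/-- It suffices to test on the π-system of the sets `B ∩ F`. There both integrals equal the integral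
over `F` of the product of the conditional probabilities of `A` and `B`, which is symmetric. -/
lemma Screens.symm (h : Screens μ mF mA mB) (hF : mF ≤ mΩ) (hA : mA ≤ mΩ) (hB : mB ≤ mΩ) :
    Screens μ mF mB mA := by
  intro A hAm
  have hAΩ := hA _ hAm
  have hS : mB ⊔ mF ≤ mΩ := sup_le hB hF
  refine (ae_eq_condExp_of_forall_setIntegral_eq hS (integrable_indicator_one hAΩ)
    (fun _ _ _ => integrable_condExp.integrableOn) ?_
    (stronglyMeasurable_condExp.mono (le_sup_right : mF ≤ mB ⊔ mF)).aestronglyMeasurable).symm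
  intro s hs _
  have hi1 : Integrable (condProb μ mF A) μ := integrable_condExp
  have hi2 : Integrable (A.indicator (fun _ => (1 : ℝ))) μ := integrable_indicator_one hAΩ
  have huniv : ∫ ω, condProb μ mF A ω ∂μ = ∫ ω, A.indicator (fun _ => (1 : ℝ)) ω ∂μ :=
    integral_condExp hF
  refine MeasurableSpace.induction_on_inter
    (C := fun s _ => ∫ ω in s, condProb μ mF A ω ∂μ =
      ∫ ω in s, A.indicator (fun _ => (1 : ℝ)) ω ∂μ)
    (sup_eq_generateFrom_inter mB mF) (isPiSystem_image2_inter mB mF) ?_ ?_ ?_ ?_ s hs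
  · simp
  · rintro _ ⟨B, hBm, F, hFm, rfl⟩
    have hBF : MeasurableSet (B ∩ F) := (hB _ hBm).inter (hF _ hFm)
    have e : ∀ ω, (B ∩ F).indicator (fun _ => (1 : ℝ)) ω =
        F.indicator (fun _ => (1 : ℝ)) ω * B.indicator (fun _ => (1 : ℝ)) ω := by
      intro ω
      by_cases h1 : ω ∈ B <;> by_cases h2 : ω ∈ F <;> simp [h1, h2]
    have hFs : StronglyMeasurable[mF] (F.indicator (fun _ => (1 : ℝ))) :=
      stronglyMeasurable_const.indicator hFm
    have hAs : StronglyMeasurable[mA] (A.indicator (fun _ => (1 : ℝ))) :=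
      stronglyMeasurable_const.indicator hAm
    have b1 : ∀ᵐ ω ∂μ, ‖F.indicator (fun _ => (1 : ℝ)) ω * condProb μ mF A ω‖ ≤ 1 := by
      filter_upwards [norm_condProb_le_one (μ := μ) hF hAΩ] with ω hω
      rw [norm_mul]
      exact mul_le_one₀ (norm_indicator_one_le _ _) (norm_nonneg _) hω
    have b2 : ∀ᵐ ω ∂μ, ‖F.indicator (fun _ => (1 : ℝ)) ω * condProb μ mF B ω‖ ≤ 1 := by
      filter_upwards [norm_condProb_le_one (μ := μ) hF (hB _ hBm)] with ω hω
      rw [norm_mul]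
      exact mul_le_one₀ (norm_indicator_one_le _ _) (norm_nonneg _) hω
    have b3 : ∀ᵐ ω ∂μ, ‖F.indicator (fun _ => (1 : ℝ)) ω * A.indicator (fun _ => (1 : ℝ)) ω‖
        ≤ 1 := ae_of_all _ fun ω => by
      rw [norm_mul]
      exact mul_le_one₀ (norm_indicator_one_le _ _) (norm_nonneg _) (norm_indicator_one_le _ _)
    have s1 := integral_mul_condExp_of_bound (μ := μ) hF
      (hFs.mul (stronglyMeasurable_condExp (m := mF) (μ := μ)
        (f := A.indicator (fun _ => (1 : ℝ))))) b1 (integrable_indicator_one (hB _ hBm))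
    have s2 := integral_mul_condExp_of_bound (μ := μ) hF
      (hFs.mul (stronglyMeasurable_condExp (m := mF) (μ := μ)
        (f := B.indicator (fun _ => (1 : ℝ))))) b2 (integrable_indicator_one hAΩ)
    have s3 := h.integral_mul_indicator hF hA hB hBm
      ((hFs.mono le_sup_right).mul (hAs.mono le_sup_left)) b3
    rw [setIntegral_eq_integral_indicator_mul hBF, setIntegral_eq_integral_indicator_mul hBF]
    calc _ = ∫ ω, F.indicator (fun _ => (1 : ℝ)) ω * condProb μ mF A ω *
            B.indicator (fun _ => (1 : ℝ)) ω ∂μ := by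
          congr 1 with ω; rw [e]; ring
      _ = _ := s1.symm
      _ = ∫ ω, F.indicator (fun _ => (1 : ℝ)) ω * condProb μ mF B ω * condProb μ mF A ω ∂μ := by
          congr 1 with ω; simp only [Pi.mul_apply]; ring
      _ = _ := s2
      _ = ∫ ω, F.indicator (fun _ => (1 : ℝ)) ω * A.indicator (fun _ => (1 : ℝ)) ω *
            condProb μ mF B ω ∂μ := by
          congr 1 with ω; simp only [Pi.mul_apply]; ring
      _ = _ := s3.symm
      _ = _ := by congr 1 with ω; rw [e]; simp only [Pi.mul_apply]; ring
  · intro t ht ih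
    have htΩ := hS _ ht
    have h1 := integral_add_compl htΩ hi1
    have h2 := integral_add_compl htΩ hi2
    linarith
  · intro f hd hf ih
    rw [integral_iUnion (fun i => hS _ (hf i)) hd hi1.integrableOn,
      integral_iUnion (fun i => hS _ (hf i)) hd hi2.integrableOn]
    exact tsum_congr ih

/-- Screening survives if the screen is refined by information of the first party. -/
lemma Screens.sup_left (h : Screens μ mF mA mB) (hF : mF ≤ mΩ) (hA : mA ≤ mΩ)
    (hm : m ≤ mA ⊔ mF) : Screens μ (mF ⊔ m) mA mB := by
  intro B hBm
  have hle : mF ⊔ m ≤ mA ⊔ mF := sup_le le_sup_right hm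
  have e : mA ⊔ (mF ⊔ m) = mA ⊔ mF :=
    le_antisymm (sup_le le_sup_left hle) (sup_le_sup_left le_sup_left _)
  rw [e]
  have h1 := h B hBm
  -- Tower property: the conditional probability given `mA ⊔ mF` is already `mF`-measurable, so
  -- conditioning on anything in between returns it unchanged.
  have h2 : condProb μ (mF ⊔ m) B =ᵐ[μ] condProb μ mF B := by
    refine (condExp_condExp_of_le hle (sup_le hA hF)).symm.trans ?_
    refine (condExp_congr_ae h1).trans ?_
    rw [condExp_of_stronglyMeasurable (hle.trans (sup_le hA hF))
      (stronglyMeasurable_condExp.mono le_sup_left) integrable_condExp]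
  exact h1.trans h2.symm

/-- Screening survives if the screen is refined by information of the second party. -/
lemma Screens.sup_right (h : Screens μ mF mA mB) (hF : mF ≤ mΩ) (hA : mA ≤ mΩ) (hB : mB ≤ mΩ)
    (hm : m ≤ mB ⊔ mF) : Screens μ (mF ⊔ m) mA mB :=
  ((h.symm hF hA hB).sup_left hF hB hm).symm (sup_le hF (hm.trans (sup_le hB hF))) hB hA

lemma screens_bot_of_indep (hA : mA ≤ mΩ) (hB : mB ≤ mΩ) (h : ProbabilityTheory.Indep mB mA μ) :
    Screens μ ⊥ mA mB := by
  intro B hBm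
  rw [sup_bot_eq]
  refine (condExp_indep_eq hB hA (stronglyMeasurable_const.indicator hBm) h).trans ?_
  rw [condProb, condExp_bot]

/-- If the inputs `X` and `Y` of two parties are screened from each other by `mF`, and no event in
`mF` distinguishes adjacent inputs of either party, then the sign `(-1) ^ ⟨X, Y⟩` is nearly
unbiased on all events known to the first party. -/
lemma Screens.abs_sum_ipSign_mul_le (h : Screens μ mF mA mB) (hF : mF ≤ mΩ) (hA : mA ≤ mΩ)
    (hB : mB ≤ mΩ) {D : ℕ} {X Y : Ω → Cube D} (hX : ∀ x, MeasurableSet[mA] (X ⁻¹' {x}))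
    (hY : ∀ y, MeasurableSet[mB] (Y ⁻¹' {y})) {E δ : ℝ} (hE : 1 ≤ E)
    (hdpX : ∀ x y j F, MeasurableSet[mF] F → μ.real (X ⁻¹' {x} ∩ Y ⁻¹' {y} ∩ F) ≤
      E * μ.real (X ⁻¹' {flipAt j x} ∩ Y ⁻¹' {y} ∩ F) + δ)
    (hdpY : ∀ x y j F, MeasurableSet[mF] F → μ.real (X ⁻¹' {x} ∩ Y ⁻¹' {y} ∩ F) ≤
      E * μ.real (X ⁻¹' {x} ∩ Y ⁻¹' {flipAt j y} ∩ F) + δ)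
    {S : Set Ω} (hS : MeasurableSet[mA ⊔ mF] S) :
    |∑ x, ∑ y, ipSign x y * μ.real (X ⁻¹' {x} ∩ Y ⁻¹' {y} ∩ S)| ≤
      √(contraction (2 * E)) ^ D + 8 * D * 4 ^ D * δ := by
  set a : Cube D → Ω → ℝ := fun x => condProb μ mF (X ⁻¹' {x}) with ha
  set b : Cube D → Ω → ℝ := fun y => condProb μ mF (Y ⁻¹' {y}) with hb
  have hXΩ : ∀ x, MeasurableSet (X ⁻¹' {x}) := fun x => hA _ (hX x)
  have hYΩ : ∀ y, MeasurableSet (Y ⁻¹' {y}) := fun y => hB _ (hY y)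
  have hSΩ : MeasurableSet S := sup_le hA hF _ hS
  have ham : ∀ x, StronglyMeasurable[mF] (a x) := fun x => stronglyMeasurable_condExp
  have hbm : ∀ y, StronglyMeasurable[mF] (b y) := fun y => stronglyMeasurable_condExp
  have hai : ∀ x, Integrable (a x) μ := fun x => integrable_condExp
  have hbi : ∀ y, Integrable (b y) μ := fun y => integrable_condExp
  have ha0 : ∀ᵐ ω ∂μ, ∀ x, 0 ≤ a x ω := ae_all_iff.2 fun x => condProb_nonneg _
  have hb0 : ∀ᵐ ω ∂μ, ∀ y, 0 ≤ b y ω := ae_all_iff.2 fun y => condProb_nonneg _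
  have ha1 : ∀ᵐ ω ∂μ, ∀ x, ‖a x ω‖ ≤ 1 := ae_all_iff.2 fun x => norm_condProb_le_one hF (hXΩ x)
  have hb1 : ∀ᵐ ω ∂μ, ∀ y, ‖b y ω‖ ≤ 1 := ae_all_iff.2 fun y => norm_condProb_le_one hF (hYΩ y)
  have hsum : ∀ (Z : Ω → Cube D), (∀ z, MeasurableSet (Z ⁻¹' {z})) →
      ∀ᵐ ω ∂μ, ∑ z, condProb μ mF (Z ⁻¹' {z}) ω = 1 := by
    intro Z hZ
    have h1 := condExp_finsetSum (μ := μ) (s := Finset.univ)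
      (f := fun z : Cube D => (Z ⁻¹' {z}).indicator (fun _ => (1 : ℝ)))
      (fun z _ => integrable_indicator_one (hZ z)) mF
    have h2 : ∑ z : Cube D, (Z ⁻¹' {z}).indicator (fun _ => (1 : ℝ)) = fun _ => (1 : ℝ) := by
      ext ω
      rw [Finset.sum_apply, Finset.sum_eq_single (Z ω)]
      · simp
      · intro z _ hz
        exact Set.indicator_of_notMem (fun h => hz h.symm) _
      · simp
    rw [h2, condExp_const hF] at h1
    filter_upwards [h1] with ω hω
    rw [Finset.sum_apply] at hω
    exact hω.symm
  have hasum := hsum X hXΩ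
  have hbsum := hsum Y hYΩ
  have hprod : ∀ x y, Integrable (fun ω => a x ω * b y ω) μ := fun x y =>
    (hbi y).bdd_mul ((ham x).mono hF).aestronglyMeasurable (ha1.mono fun ω hω => hω x)
  -- measures of events in the screen
  have hindS : ∀ (x : Cube D) {T : Set Ω}, MeasurableSet[mA ⊔ mF] T → ∀ y,
      μ.real (X ⁻¹' {x} ∩ Y ⁻¹' {y} ∩ T) =
        ∫ ω, (X ⁻¹' {x} ∩ T).indicator (fun _ => (1 : ℝ)) ω * b y ω ∂μ := by
    intro x T hT y
    have hXT : MeasurableSet[mA ⊔ mF] (X ⁻¹' {x} ∩ T) :=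
      MeasurableSet.inter ((le_sup_left : mA ≤ mA ⊔ mF) _ (hX x)) hT
    rw [← h.integral_mul_indicator hF hA hB (hY y) (stronglyMeasurable_const.indicator hXT)
      (ae_of_all _ (norm_indicator_one_le _)),
      real_eq_integral_indicator (((hXΩ x).inter (hYΩ y)).inter (sup_le hA hF _ hT))]
    congr 1 with ω
    by_cases h1 : ω ∈ X ⁻¹' {x} <;> by_cases h2 : ω ∈ Y ⁻¹' {y} <;> by_cases h3 : ω ∈ T <;>
      simp only [Set.indicator, Set.mem_inter_iff, h1, h2, h3] <;> simp
  have hindF : ∀ x y F, MeasurableSet[mF] F → μ.real (X ⁻¹' {x} ∩ Y ⁻¹' {y} ∩ F) =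
      ∫ ω in F, a x ω * b y ω ∂μ := by
    intro x y F hFm
    rw [hindS x ((le_sup_right : mF ≤ mA ⊔ mF) _ hFm) y,
      setIntegral_eq_integral_indicator_mul (hF _ hFm)]
    have := integral_mul_condExp_of_bound (μ := μ) hF (f := (X ⁻¹' {x}).indicator fun _ => (1 : ℝ))
      ((stronglyMeasurable_const (b := (1 : ℝ))).indicator hFm |>.mul (hbm y)) (c := 1) (by
        filter_upwards [hb1] with ω hω
        rw [Pi.mul_apply, norm_mul]
        exact mul_le_one₀ (norm_indicator_one_le _ _) (norm_nonneg _) (hω y))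
      (integrable_indicator_one (hXΩ x))
    simp only [Pi.mul_apply] at this
    calc _ = _ := ?_
      _ = _ := this.symm
      _ = _ := by congr 1 with ω; rw [ha]; ring
    congr 1 with ω
    by_cases h1 : ω ∈ X ⁻¹' {x} <;> by_cases h3 : ω ∈ F <;>
      simp only [Set.indicator, Set.mem_inter_iff, h1, h3] <;> simp
  -- the defects
  have hdefect : ∀ p q r : Ω → ℝ, StronglyMeasurable[mF] p → StronglyMeasurable[mF] q →
      (0 ≤ᵐ[μ] r) → Integrable (fun ω => p ω * r ω) μ → Integrable (fun ω => q ω * r ω) μ →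
      (∀ F, MeasurableSet[mF] F →
        ∫ ω in F, p ω * r ω ∂μ ≤ E * ∫ ω in F, q ω * r ω ∂μ + δ) →
      Integrable (fun ω => max 0 (p ω - E * q ω) * r ω) μ ∧
        ∫ ω, max 0 (p ω - E * q ω) * r ω ∂μ ≤ δ := by
    intro p q r hp hq hr hpr hqr hpq
    -- The event on which the ratio bound fails lies in the screen, so privacy applied to it bounds
    -- the whole expected positive part by `δ`.
    set F : Set Ω := {ω | E * q ω < p ω} with hFdef
    have hFm : MeasurableSet[mF] F :=
      measurableSet_lt (hq.measurable.const_mul E) hp.measurable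
    have e : (fun ω => max 0 (p ω - E * q ω) * r ω) =
        F.indicator (fun ω => p ω * r ω - E * (q ω * r ω)) := by
      ext ω
      by_cases hω : ω ∈ F
      · rw [Set.indicator_of_mem hω, max_eq_right (sub_nonneg.2 (le_of_lt hω))]; ring
      · rw [Set.indicator_of_notMem hω,
          max_eq_left (sub_nonpos.2 (not_lt.1 hω)), zero_mul]
    have hi : Integrable (fun ω => p ω * r ω - E * (q ω * r ω)) μ := hpr.sub (hqr.const_mul E)
    rw [e]
    refine ⟨hi.indicator (hF _ hFm), ?_⟩
    rw [integral_indicator (hF _ hFm), integral_sub hpr.integrableOn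
      (hqr.const_mul E).integrableOn, integral_const_mul]
    linarith [hpq F hFm]
  -- The weight `b y` is present because privacy of one input holds for each fixed value of the
  -- other; summing over `y` removes it.
  have hdX : ∀ x y j, Integrable (fun ω => max 0 (a x ω - E * a (flipAt j x) ω) * b y ω) μ ∧
      ∫ ω, max 0 (a x ω - E * a (flipAt j x) ω) * b y ω ∂μ ≤ δ := fun x y j =>
    hdefect _ _ _ (ham x) (ham _) (hb0.mono fun ω hω => hω y) (hprod x y) (hprod _ y)
      fun F hFm => by
        rw [← hindF x y F hFm, ← hindF _ y F hFm]; exact hdpX x y j F hFm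
  have hprod' : ∀ x y, Integrable (fun ω => b y ω * a x ω) μ := fun x y => by
    simpa only [mul_comm] using hprod x y
  have hdY : ∀ x y j, Integrable (fun ω => max 0 (b y ω - E * b (flipAt j y) ω) * a x ω) μ ∧
      ∫ ω, max 0 (b y ω - E * b (flipAt j y) ω) * a x ω ∂μ ≤ δ := fun x y j =>
    hdefect _ _ _ (hbm y) (hbm _) (ha0.mono fun ω hω => hω x) (hprod' x y) (hprod' x _)
      fun F hFm => by
        simp only [mul_comm (b _ _)]
        rw [← hindF x y F hFm, ← hindF x _ F hFm]; exact hdpY x y j F hFm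
  -- the total defects
  have hswap : ∀ p q : Cube D → Ω → ℝ,
      (∀ x y j, Integrable (fun ω => max 0 (p x ω - E * p (flipAt j x) ω) * q y ω) μ ∧
        ∫ ω, max 0 (p x ω - E * p (flipAt j x) ω) * q y ω ∂μ ≤ δ) →
      Integrable (fun ω => (∑ y, q y ω) * ratioDefect E (fun x => p x ω)) μ ∧
      ∫ ω, (∑ y, q y ω) * ratioDefect E (fun x => p x ω) ∂μ ≤ D * 4 ^ D * δ := by
    intro p q hpq
    have e : (fun ω => (∑ y, q y ω) * ratioDefect E (fun x => p x ω)) =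
        fun ω => ∑ y, ∑ j, ∑ x, max 0 (p x ω - E * p (flipAt j x) ω) * q y ω := by
      ext ω
      simp only [ratioDefect, Finset.sum_mul]
      refine Finset.sum_congr rfl fun y _ => ?_
      simp only [Finset.mul_sum, mul_comm]
    rw [e]
    refine ⟨integrable_finsetSum _ fun y _ => integrable_finsetSum _ fun j _ =>
      integrable_finsetSum _ fun x _ => (hpq x y j).1, ?_⟩
    rw [integral_finsetSum _ fun y _ => integrable_finsetSum _ fun j _ =>
      integrable_finsetSum _ fun x _ => (hpq x y j).1]
    calc _ ≤ ∑ _y : Cube D, ∑ _j : Fin D, ∑ _x : Cube D, δ := by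
          refine Finset.sum_le_sum fun y _ => ?_
          rw [integral_finsetSum _ fun j _ => integrable_finsetSum _ fun x _ => (hpq x y j).1]
          refine Finset.sum_le_sum fun j _ => ?_
          rw [integral_finsetSum _ fun x _ => (hpq x y j).1]
          exact Finset.sum_le_sum fun x _ => (hpq x y j).2
      _ = _ := by
          simp only [Finset.sum_const, Finset.card_univ, Fintype.card_fun, Fintype.card_bool,
            Fintype.card_fin, nsmul_eq_mul, Nat.cast_pow, Nat.cast_ofNat]
          rw [show (4 : ℝ) = 2 * 2 by norm_num, mul_pow]; ring
  obtain ⟨hiA, hdA⟩ := hswap a b hdX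
  obtain ⟨hiB, hdB⟩ := hswap b a fun y x j => hdY x y j
  have hfbm : ∀ x, StronglyMeasurable[mF] (fun ω => |fourier (fun y => b y ω) x|) := by
    intro x
    refine @StronglyMeasurable.norm _ mF _ _ (fun ω => fourier (fun y => b y ω) x) ?_
    exact Finset.stronglyMeasurable_fun_sum Finset.univ
      (fun y _ => (hbm y).const_mul (ipSign x y))
  have hfb1 : ∀ x, ∀ᵐ ω ∂μ, ‖|fourier (fun y => b y ω) x|‖ ≤ 1 := by
    intro x
    filter_upwards [hb0, hbsum] with ω h0 h1
    rw [norm_abs_eq_norm, Real.norm_eq_abs]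
    refine (abs_fourier_le _ x).trans (le_of_eq ?_)
    rw [← h1]
    exact Finset.sum_congr rfl fun y _ => abs_of_nonneg (h0 y)
  have hiaf : ∀ x, Integrable (fun ω => |fourier (fun y => b y ω) x| * a x ω) μ := fun x =>
    (hai x).bdd_mul ((hfbm x).mono hF).aestronglyMeasurable (hfb1 x)
  calc |∑ x, ∑ y, ipSign x y * μ.real (X ⁻¹' {x} ∩ Y ⁻¹' {y} ∩ S)|
      ≤ ∑ x, |∑ y, ipSign x y * μ.real (X ⁻¹' {x} ∩ Y ⁻¹' {y} ∩ S)| :=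
        Finset.abs_sum_le_sum_abs _ _
    _ ≤ ∑ x, ∫ ω, |fourier (fun y => b y ω) x| * a x ω ∂μ := by
        refine Finset.sum_le_sum fun x _ => ?_
        have hXS : MeasurableSet (X ⁻¹' {x} ∩ S) := (hXΩ x).inter hSΩ
        have hint : ∀ y, Integrable
            (fun ω => (X ⁻¹' {x} ∩ S).indicator (fun _ => (1 : ℝ)) ω * b y ω) μ := fun y =>
          (hbi y).bdd_mul (c := 1) (integrable_indicator_one hXS).aestronglyMeasurable
            (ae_of_all _ (norm_indicator_one_le _))
        have e1 : ∑ y, ipSign x y * μ.real (X ⁻¹' {x} ∩ Y ⁻¹' {y} ∩ S) =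
            ∫ ω, (X ⁻¹' {x} ∩ S).indicator (fun _ => (1 : ℝ)) ω *
              fourier (fun y => b y ω) x ∂μ := by
          simp only [hindS x hS, fourier, Finset.mul_sum]
          rw [integral_finsetSum _ fun y _ => by
            simpa only [mul_left_comm] using (hint y).const_mul (ipSign x y)]
          refine Finset.sum_congr rfl fun y _ => ?_
          rw [← integral_const_mul]
          congr 1 with ω
          ring
        -- The absolute value of the transform allows `S` to be dropped from the indicator. What
        -- remains depends on the first party only through `X`, and conditioning on the screen
        -- replaces its indicator by `a x`.
        rw [e1, integral_mul_condExp_of_bound hF (hfbm x) (hfb1 x)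
          (integrable_indicator_one (hXΩ x))]
        refine abs_integral_le_integral_abs.trans (integral_mono_of_nonneg
          (ae_of_all _ fun ω => abs_nonneg _) ((integrable_indicator_one (hXΩ x)).bdd_mul
          ((hfbm x).mono hF).aestronglyMeasurable (hfb1 x)) (ae_of_all _ fun ω => ?_))
        by_cases h1 : ω ∈ X ⁻¹' {x} <;> by_cases h3 : ω ∈ S <;>
          simp only [Set.indicator, Set.mem_inter_iff, h1, h3] <;> simp
    _ = ∫ ω, ∑ x, a x ω * |fourier (fun y => b y ω) x| ∂μ := by
        rw [integral_finsetSum _ fun x _ => by simpa only [mul_comm] using hiaf x]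
        simp only [mul_comm]
    _ ≤ ∫ ω, (√(contraction (2 * E)) ^ D +
          4 * ((∑ y, b y ω) * ratioDefect E (fun x => a x ω) +
            (∑ x, a x ω) * ratioDefect E (fun y => b y ω))) ∂μ := by
        refine integral_mono_ae (integrable_finsetSum _ fun x _ => by
          simpa only [mul_comm] using hiaf x)
          ((integrable_const _).add ((hiA.add hiB).const_mul 4)) ?_
        filter_upwards [ha0, hb0, hasum, hbsum] with ω h1 h2 h3 h4
        have := sum_mul_abs_fourier_le hE h1 h2
        rw [show ∑ x, a x ω = 1 from h3, show ∑ y, b y ω = 1 from h4] at this ⊢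
        simpa using this
    _ = √(contraction (2 * E)) ^ D +
          4 * (∫ ω, (∑ y, b y ω) * ratioDefect E (fun x => a x ω) ∂μ +
            ∫ ω, (∑ x, a x ω) * ratioDefect E (fun y => b y ω) ∂μ) := by
        have hiAB : Integrable (fun ω => 4 * ((∑ y, b y ω) * ratioDefect E (fun x => a x ω) +
            (∑ x, a x ω) * ratioDefect E (fun y => b y ω))) μ := (hiA.add hiB).const_mul 4
        rw [integral_add (integrable_const _) hiAB, integral_const_mul, integral_add hiA hiB]
        simp
    _ ≤ _ := by linarith

end

/-! ### Protocols with uniformly random inputs -/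

/-- Private coins together with a uniformly random point of the cube. -/
noncomputable def withUniform {C : Type} [MeasurableSpace C] (ν : Measure C) (D : ℕ) :
    Measure (Cube D × C) :=
  (ProbabilityTheory.uniformOn (Set.univ : Set (Cube D))).prod ν

instance (D : ℕ) : IsProbabilityMeasure
    (ProbabilityTheory.uniformOn (Set.univ : Set (Cube D))) :=
  ProbabilityTheory.isProbabilityMeasure_uniformOn Set.finite_univ Set.univ_nonempty

instance {C : Type} [MeasurableSpace C] (ν : Measure C) [IsProbabilityMeasure ν] (D : ℕ) :
    IsProbabilityMeasure (withUniform ν D) := by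
  unfold withUniform; infer_instance

lemma withUniform_restrict {C : Type} [MeasurableSpace C] (ν : Measure C)
    [IsProbabilityMeasure ν] {D : ℕ} (x : Cube D) :
    (withUniform ν D).restrict ({x} ×ˢ Set.univ) =
      ((2 : ENNReal) ^ D)⁻¹ • ν.map (Prod.mk x) := by
  rw [withUniform, ← Measure.prod_restrict, Measure.restrict_univ, Measure.restrict_singleton,
    Measure.prod_smul_left, Measure.dirac_prod, ProbabilityTheory.uniformOn_univ]
  simp

/-- Transfers statements about fixed inputs to a single probability space on which the inputs are
random: fixing both inputs costs a factor `4 ^ (-D)` and leaves the coins independent with their own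
laws. -/
lemma real_prod_withUniform {C C' : Type} [MeasurableSpace C] [MeasurableSpace C']
    (ν : Measure C) (ν' : Measure C') [IsProbabilityMeasure ν] [IsProbabilityMeasure ν'] {D : ℕ}
    (x y : Cube D) {S : Set ((Cube D × C) × (Cube D × C'))} (hS : MeasurableSet S) :
    ((withUniform ν D).prod (withUniform ν' D)).real
      ((fun ω => ω.1.1) ⁻¹' {x} ∩ (fun ω => ω.2.1) ⁻¹' {y} ∩ S) =
      (1 / 4) ^ D * (ν.prod ν').real {r | ((x, r.1), (y, r.2)) ∈ S} := by
  have e : ((fun ω : (Cube D × C) × (Cube D × C') => ω.1.1) ⁻¹' {x} ∩ (fun ω => ω.2.1) ⁻¹' {y}) =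
      ({x} ×ˢ Set.univ) ×ˢ ({y} ×ˢ Set.univ) := by
    ext ω; simp
  rw [e, Set.inter_comm, measureReal_def, ← Measure.restrict_apply hS, ← Measure.prod_restrict,
    withUniform_restrict, withUniform_restrict, Measure.prod_smul_left, Measure.prod_smul_right,
    Measure.map_prod_map _ _ measurable_prodMk_left measurable_prodMk_left, smul_smul,
    Measure.smul_apply, Measure.map_apply
      (measurable_prodMk_left.prodMap measurable_prodMk_left) hS, smul_eq_mul,
    ENNReal.toReal_mul, measureReal_def]
  congr 1
  rw [ENNReal.toReal_mul, ENNReal.toReal_inv, ENNReal.toReal_pow, ENNReal.toReal_ofNat,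
    ← mul_inv, ← mul_pow, one_div, inv_pow]
  norm_num

lemma comap_snoc {Ω M : Type*} [MeasurableSpace M] {k : ℕ} (f : Ω → Fin k → M) (g : Ω → M) :
    MeasurableSpace.comap (fun ω => Fin.snoc (α := fun _ => M) (f ω) (g ω) : Ω → Fin (k + 1) → M)
      inferInstance =
    MeasurableSpace.comap f inferInstance ⊔ MeasurableSpace.comap g inferInstance := by
  refine le_antisymm ?_ (sup_le ?_ ?_)
  · let _ : MeasurableSpace Ω :=
      MeasurableSpace.comap f inferInstance ⊔ MeasurableSpace.comap g inferInstance
    refine Measurable.comap_le (measurable_pi_iff.2 fun i => ?_)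
    refine Fin.lastCases ?_ (fun j => ?_) i
    · simp only [Fin.snoc_last]
      exact (comap_measurable g).mono le_sup_right le_rfl
    · simp only [Fin.snoc_castSucc]
      exact ((measurable_pi_apply j).comp (comap_measurable f)).mono le_sup_left le_rfl
  all_goals
    let _ : MeasurableSpace Ω := MeasurableSpace.comap
      (fun ω => Fin.snoc (α := fun _ => M) (f ω) (g ω) : Ω → Fin (k + 1) → M) inferInstance
    have hm : Measurable
        (fun ω => Fin.snoc (α := fun _ => M) (f ω) (g ω) : Ω → Fin (k + 1) → M) :=
      comap_measurable _
  · refine Measurable.comap_le (measurable_pi_iff.2 fun j => ?_)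
    simpa only [Function.comp_def, Fin.snoc_castSucc] using
      (measurable_pi_apply (X := fun _ => M) j.castSucc).comp hm
  · refine Measurable.comap_le ?_
    simpa only [Function.comp_def, Fin.snoc_last] using
      (measurable_pi_apply (X := fun _ => M) (Fin.last k)).comp hm

namespace Protocol

variable {𝒳 : Type} {n : ℕ} (P : Protocol 𝒳 n) {D : ℕ} (eA eB : Cube D → Fin n → 𝒳)

/-- The inputs (encoded by points of the cube) and private coins of both parties. -/
abbrev Seeds (D : ℕ) : Type := (Cube D × P.CoinsA) × (Cube D × P.CoinsB)

/-- Uniformly random points of the cube together with the private coins of the parties. -/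
noncomputable def seedLaw (D : ℕ) : Measure (P.Seeds D) :=
  (withUniform P.lawA D).prod (withUniform P.lawB D)

instance : IsProbabilityMeasure (P.seedLaw D) := by
  unfold seedLaw; infer_instance

/-- The first `k` messages as a function of the encoded inputs and the coins. -/
def seedMessages (k : ℕ) (ω : P.Seeds D) : Fin k → P.Msg :=
  P.messages (eA ω.1.1) (eB ω.2.1) (ω.1.2, ω.2.2) k

/-- The message number `k` as a function of the encoded inputs and the coins. -/
def seedMessage (k : ℕ) (ω : P.Seeds D) : P.Msg :=
  if Even k then P.sendA k (eA ω.1.1) ω.1.2 (P.seedMessages eA eB k ω)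
    else P.sendB k (eB ω.2.1) ω.2.2 (P.seedMessages eA eB k ω)

/-- The σ-algebra of the first `k` messages. -/
abbrev messageSpace (D : ℕ) (eA eB : Cube D → Fin n → 𝒳) (k : ℕ) : MeasurableSpace (P.Seeds D) :=
  MeasurableSpace.comap (P.seedMessages eA eB k) inferInstance

/-- The σ-algebra of the seed of `A`. -/
abbrev seedSpaceA (D : ℕ) : MeasurableSpace (P.Seeds D) :=
  MeasurableSpace.comap Prod.fst inferInstance

/-- The σ-algebra of the seed of `B`. -/
abbrev seedSpaceB (D : ℕ) : MeasurableSpace (P.Seeds D) :=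
  MeasurableSpace.comap Prod.snd inferInstance

lemma seedSpaceA_le : P.seedSpaceA D ≤ Prod.instMeasurableSpace := measurable_fst.comap_le

lemma seedSpaceB_le : P.seedSpaceB D ≤ Prod.instMeasurableSpace := measurable_snd.comap_le

lemma messageSpace_zero : P.messageSpace D eA eB 0 = ⊥ := by
  have : P.seedMessages eA eB 0 = fun _ => Fin.elim0 := by
    ext ω k; exact k.elim0
  rw [messageSpace, this, MeasurableSpace.comap_const]

lemma messageSpace_succ (k : ℕ) : P.messageSpace D eA eB (k + 1) =
    P.messageSpace D eA eB k ⊔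
      MeasurableSpace.comap (P.seedMessage eA eB k) inferInstance := by
  exact comap_snoc (P.seedMessages eA eB k) (P.seedMessage eA eB k)

/-- The only place where the turn structure of a protocol enters: a message is determined by its
sender's seed and the earlier messages. -/
lemma comap_seedMessage_le (k : ℕ) :
    MeasurableSpace.comap (P.seedMessage eA eB k) inferInstance ≤
      (if Even k then P.seedSpaceA D else P.seedSpaceB D) ⊔ P.messageSpace D eA eB k := by
  split_ifs with hk
  · refine Measurable.comap_le (m₁ := P.seedSpaceA D ⊔ P.messageSpace D eA eB k) ?_
    have hs : Measurable fun p : Cube D × (P.CoinsA × (Fin k → P.Msg)) =>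
        P.sendA k (eA p.1) p.2.1 p.2.2 :=
      measurable_from_prod_countable_right fun x => P.measurable_sendA k (eA x)
    have h1 : Measurable[P.seedSpaceA D ⊔ P.messageSpace D eA eB k]
        (Prod.fst : P.Seeds D → Cube D × P.CoinsA) :=
      (comap_measurable _).mono le_sup_left le_rfl
    have h2 : Measurable[P.seedSpaceA D ⊔ P.messageSpace D eA eB k]
        (P.seedMessages eA eB k) := (comap_measurable _).mono le_sup_right le_rfl
    have h3 := hs.comp ((measurable_fst.comp h1).prodMk ((measurable_snd.comp h1).prodMk h2))
    have e : P.seedMessage eA eB k = fun ω =>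
        P.sendA k (eA ω.1.1) ω.1.2 (P.seedMessages eA eB k ω) := by
      ext ω; rw [seedMessage, if_pos hk]
    rw [e]
    exact h3
  · refine Measurable.comap_le (m₁ := P.seedSpaceB D ⊔ P.messageSpace D eA eB k) ?_
    have hs : Measurable fun p : Cube D × (P.CoinsB × (Fin k → P.Msg)) =>
        P.sendB k (eB p.1) p.2.1 p.2.2 :=
      measurable_from_prod_countable_right fun x => P.measurable_sendB k (eB x)
    have h1 : Measurable[P.seedSpaceB D ⊔ P.messageSpace D eA eB k]
        (Prod.snd : P.Seeds D → Cube D × P.CoinsB) :=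
      (comap_measurable _).mono le_sup_left le_rfl
    have h2 : Measurable[P.seedSpaceB D ⊔ P.messageSpace D eA eB k]
        (P.seedMessages eA eB k) := (comap_measurable _).mono le_sup_right le_rfl
    have h3 := hs.comp ((measurable_fst.comp h1).prodMk ((measurable_snd.comp h1).prodMk h2))
    have e : P.seedMessage eA eB k = fun ω =>
        P.sendB k (eB ω.2.1) ω.2.2 (P.seedMessages eA eB k ω) := by
      ext ω; rw [seedMessage, if_neg hk]
    rw [e]
    exact h3

lemma messageSpace_le (k : ℕ) : P.messageSpace D eA eB k ≤ Prod.instMeasurableSpace := by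
  induction k with
  | zero => rw [messageSpace_zero]; exact bot_le
  | succ k ih =>
    rw [messageSpace_succ]
    refine sup_le ih ((P.comap_seedMessage_le eA eB k).trans (sup_le ?_ ih))
    split_ifs
    · exact P.seedSpaceA_le
    · exact P.seedSpaceB_le

/-- The seeds of the parties are independent given the messages. -/
lemma screens_messageSpace (k : ℕ) :
    Screens (P.seedLaw D) (P.messageSpace D eA eB k) (P.seedSpaceA D) (P.seedSpaceB D) := by
  induction k with
  | zero =>
    rw [messageSpace_zero]
    refine screens_bot_of_indep P.seedSpaceA_le P.seedSpaceB_le ?_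
    exact (ProbabilityTheory.indepFun_prod (μ := withUniform P.lawA D)
      (ν := withUniform P.lawB D) measurable_id measurable_id).symm
  | succ k ih =>
    rw [messageSpace_succ]
    have h := P.comap_seedMessage_le eA eB k
    split_ifs at h
    · exact ih.sup_left (P.messageSpace_le eA eB k) P.seedSpaceA_le h
    · exact ih.sup_right (P.messageSpace_le eA eB k) P.seedSpaceA_le P.seedSpaceB_le h

lemma measurableSet_preimage_inputA (x : Cube D) :
    MeasurableSet[P.seedSpaceA D] ((fun ω : P.Seeds D => ω.1.1) ⁻¹' {x}) :=
  (measurable_fst.comp (comap_measurable (Prod.fst : P.Seeds D → _))) (measurableSet_singleton x)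

lemma measurableSet_preimage_inputB (y : Cube D) :
    MeasurableSet[P.seedSpaceB D] ((fun ω : P.Seeds D => ω.2.1) ⁻¹' {y}) :=
  (measurable_fst.comp (comap_measurable (Prod.snd : P.Seeds D → _))) (measurableSet_singleton y)

lemma real_seedLaw (x y : Cube D) {S : Set (P.Seeds D)} (hS : MeasurableSet S) :
    (P.seedLaw D).real ((fun ω => ω.1.1) ⁻¹' {x} ∩ (fun ω => ω.2.1) ⁻¹' {y} ∩ S) =
      (1 / 4) ^ D * P.law.real {r | ((x, r.1), (y, r.2)) ∈ S} :=
  real_prod_withUniform P.lawA P.lawB x y hS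

variable {eA eB} [MeasurableSpace 𝒳] {ε δ E : ℝ}

lemma IsTwoPartyDP.real_messageSpace_le_left (hP : P.IsTwoPartyDP ε δ) (hE : Real.exp ε ≤ E)
    (hA : ∀ x j, Neighbouring (eA x) (eA (flipAt j x))) (x y : Cube D) (j : Fin D)
    (F : Set (P.Seeds D)) (hF : MeasurableSet[P.messageSpace D eA eB P.rounds] F) :
    (P.seedLaw D).real ((fun ω => ω.1.1) ⁻¹' {x} ∩ (fun ω => ω.2.1) ⁻¹' {y} ∩ F) ≤
      E * (P.seedLaw D).real
        ((fun ω => ω.1.1) ⁻¹' {flipAt j x} ∩ (fun ω => ω.2.1) ⁻¹' {y} ∩ F) +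
      (1 / 4) ^ D * δ := by
  have hFm := P.messageSpace_le eA eB P.rounds F hF
  obtain ⟨T, hT, rfl⟩ := hF
  -- A change of the input of `A` is hidden from the view of `B`; only the transcript in that view
  -- is tested.
  have h := hP.2 (eB y) _ _ (hA x j) {v | v.2.2 ∈ T}
    ((measurable_snd.comp measurable_snd) hT)
  rw [P.real_seedLaw x y hFm, P.real_seedLaw _ y hFm]
  have h' : P.law.real {r | ((x, r.1), (y, r.2)) ∈ P.seedMessages eA eB P.rounds ⁻¹' T} ≤
      E * P.law.real {r | ((flipAt j x, r.1), (y, r.2)) ∈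
        P.seedMessages eA eB P.rounds ⁻¹' T} + δ :=
    h.trans (add_le_add (mul_le_mul_of_nonneg_right hE measureReal_nonneg) le_rfl)
  calc _ ≤ (1 / 4 : ℝ) ^ D * (E * P.law.real {r | ((flipAt j x, r.1), (y, r.2)) ∈
        P.seedMessages eA eB P.rounds ⁻¹' T} + δ) := by gcongr
    _ = _ := by ring

lemma IsTwoPartyDP.real_messageSpace_le_right (hP : P.IsTwoPartyDP ε δ) (hE : Real.exp ε ≤ E)
    (hB : ∀ y j, Neighbouring (eB y) (eB (flipAt j y))) (x y : Cube D) (j : Fin D)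
    (F : Set (P.Seeds D)) (hF : MeasurableSet[P.messageSpace D eA eB P.rounds] F) :
    (P.seedLaw D).real ((fun ω => ω.1.1) ⁻¹' {x} ∩ (fun ω => ω.2.1) ⁻¹' {y} ∩ F) ≤
      E * (P.seedLaw D).real
        ((fun ω => ω.1.1) ⁻¹' {x} ∩ (fun ω => ω.2.1) ⁻¹' {flipAt j y} ∩ F) +
      (1 / 4) ^ D * δ := by
  have hFm := P.messageSpace_le eA eB P.rounds F hF
  obtain ⟨T, hT, rfl⟩ := hF
  have h := hP.1 (eA x) _ _ (hB y j) {v | v.2.2 ∈ T}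
    ((measurable_snd.comp measurable_snd) hT)
  rw [P.real_seedLaw x y hFm, P.real_seedLaw x _ hFm]
  have h' : P.law.real {r | ((x, r.1), (y, r.2)) ∈ P.seedMessages eA eB P.rounds ⁻¹' T} ≤
      E * P.law.real {r | ((x, r.1), (flipAt j y, r.2)) ∈
        P.seedMessages eA eB P.rounds ⁻¹' T} + δ :=
    h.trans (add_le_add (mul_le_mul_of_nonneg_right hE measureReal_nonneg) le_rfl)
  calc _ ≤ (1 / 4 : ℝ) ^ D * (E * P.law.real {r | ((x, r.1), (flipAt j y, r.2)) ∈
        P.seedMessages eA eB P.rounds ⁻¹' T} + δ) := by gcongr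
    _ = _ := by ring

/-- With random inputs the additive privacy error is `4 ^ (-D) * δ`, which cancels the number `4 ^
D` of input pairs over which defects are summed. So `δ` is multiplied only by a term linear in `D`.
-/
lemma mul_bound_of_quarter_pow {D : ℕ} {s t u : ℝ}
    (h : |(1 / 4) ^ D * s| ≤ t + 8 * D * 4 ^ D * ((1 / 4) ^ D * u)) :
    |s| ≤ 4 ^ D * (t + 8 * D * u) := by
  have e : (4 : ℝ) ^ D * (1 / 4) ^ D = 1 := by rw [← mul_pow]; norm_num
  have h4 : (0 : ℝ) < 4 ^ D := by positivity
  rw [abs_mul, abs_of_pos (by positivity)] at h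
  calc |s| = 4 ^ D * ((1 / 4) ^ D * |s|) := by rw [← mul_assoc, e, one_mul]
    _ ≤ 4 ^ D * (t + 8 * D * 4 ^ D * ((1 / 4) ^ D * u)) := by gcongr
    _ = 4 ^ D * (t + 8 * D * (4 ^ D * (1 / 4) ^ D) * u) := by ring
    _ = _ := by rw [e, mul_one]

/-- In a two-party DP protocol the view of `A` carries almost no information on the inner product
modulo 2 of uniformly random inputs. -/
lemma IsTwoPartyDP.abs_sum_ipSign_viewA_le (hP : P.IsTwoPartyDP ε δ) (hE : Real.exp ε ≤ E)
    (hE1 : 1 ≤ E) (hA : ∀ x j, Neighbouring (eA x) (eA (flipAt j x)))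
    (hB : ∀ y j, Neighbouring (eB y) (eB (flipAt j y))) {T : Set P.ViewA}
    (hT : MeasurableSet T) :
    |∑ x, ∑ y, ipSign x y * P.law.real {r | P.viewA (eA x) (eB y) r ∈ T}| ≤
      4 ^ D * (√(contraction (2 * E)) ^ D + 8 * D * δ) := by
  set V : P.Seeds D → P.ViewA := fun ω => P.viewA (eA ω.1.1) (eB ω.2.1) (ω.1.2, ω.2.2) with hV
  -- The view contains the whole input and coins of `A`, hence the need for a bias bound on all
  -- events in the join with the seed of `A`.
  have hVm : Measurable[P.seedSpaceA D ⊔ P.messageSpace D eA eB P.rounds] V := by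
    have h1 : Measurable[P.seedSpaceA D ⊔ P.messageSpace D eA eB P.rounds]
        (Prod.fst : P.Seeds D → Cube D × P.CoinsA) :=
      (comap_measurable _).mono le_sup_left le_rfl
    have h2 : Measurable[P.seedSpaceA D ⊔ P.messageSpace D eA eB P.rounds]
        (P.seedMessages eA eB P.rounds) := (comap_measurable _).mono le_sup_right le_rfl
    exact ((measurable_of_countable eA).comp (measurable_fst.comp h1)).prodMk
      ((measurable_snd.comp h1).prodMk h2)
  have hS : MeasurableSet[P.seedSpaceA D ⊔ P.messageSpace D eA eB P.rounds] (V ⁻¹' T) := hVm hT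
  have hSm : MeasurableSet (V ⁻¹' T) :=
    sup_le P.seedSpaceA_le (P.messageSpace_le eA eB P.rounds) _ hS
  have h := (P.screens_messageSpace eA eB P.rounds).abs_sum_ipSign_mul_le
    (P.messageSpace_le eA eB P.rounds) P.seedSpaceA_le P.seedSpaceB_le
    P.measurableSet_preimage_inputA P.measurableSet_preimage_inputB hE1
    (hP.real_messageSpace_le_left P hE hA) (hP.real_messageSpace_le_right P hE hB) hS
  refine mul_bound_of_quarter_pow (le_trans (le_of_eq ?_) h)
  simp only [P.real_seedLaw _ _ hSm, Finset.mul_sum]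
  congr 1
  refine Finset.sum_congr rfl fun x _ => Finset.sum_congr rfl fun y _ => ?_
  rw [mul_left_comm]
  rfl

/-- In a two-party DP protocol the view of `B` carries almost no information on the inner product
modulo 2 of uniformly random inputs. -/
lemma IsTwoPartyDP.abs_sum_ipSign_viewB_le (hP : P.IsTwoPartyDP ε δ) (hE : Real.exp ε ≤ E)
    (hE1 : 1 ≤ E) (hA : ∀ x j, Neighbouring (eA x) (eA (flipAt j x)))
    (hB : ∀ y j, Neighbouring (eB y) (eB (flipAt j y))) {T : Set P.ViewB}
    (hT : MeasurableSet T) :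
    |∑ x, ∑ y, ipSign x y * P.law.real {r | P.viewB (eA x) (eB y) r ∈ T}| ≤
      4 ^ D * (√(contraction (2 * E)) ^ D + 8 * D * δ) := by
  set V : P.Seeds D → P.ViewB := fun ω => P.viewB (eA ω.1.1) (eB ω.2.1) (ω.1.2, ω.2.2) with hV
  have hVm : Measurable[P.seedSpaceB D ⊔ P.messageSpace D eA eB P.rounds] V := by
    have h1 : Measurable[P.seedSpaceB D ⊔ P.messageSpace D eA eB P.rounds]
        (Prod.snd : P.Seeds D → Cube D × P.CoinsB) :=
      (comap_measurable _).mono le_sup_left le_rfl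
    have h2 : Measurable[P.seedSpaceB D ⊔ P.messageSpace D eA eB P.rounds]
        (P.seedMessages eA eB P.rounds) := (comap_measurable _).mono le_sup_right le_rfl
    exact ((measurable_of_countable eB).comp (measurable_fst.comp h1)).prodMk
      ((measurable_snd.comp h1).prodMk h2)
  have hS : MeasurableSet[P.seedSpaceB D ⊔ P.messageSpace D eA eB P.rounds] (V ⁻¹' T) := hVm hT
  have hSm : MeasurableSet (V ⁻¹' T) :=
    sup_le P.seedSpaceB_le (P.messageSpace_le eA eB P.rounds) _ hS
  have h := ((P.screens_messageSpace eA eB P.rounds).symm (P.messageSpace_le eA eB P.rounds)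
    P.seedSpaceA_le P.seedSpaceB_le).abs_sum_ipSign_mul_le
    (P.messageSpace_le eA eB P.rounds) P.seedSpaceB_le P.seedSpaceA_le
    P.measurableSet_preimage_inputB P.measurableSet_preimage_inputA hE1
    (fun y x j F hF => by
      simpa only [Set.inter_comm] using hP.real_messageSpace_le_right P hE hB x y j F hF)
    (fun y x j F hF => by
      simpa only [Set.inter_comm] using hP.real_messageSpace_le_left P hE hA x y j F hF) hS
  refine mul_bound_of_quarter_pow (le_trans (le_of_eq ?_) h)
  rw [Finset.sum_comm]
  simp only [Set.inter_comm ((fun ω : P.Seeds D => ω.2.1) ⁻¹' _), P.real_seedLaw _ _ hSm,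
    Finset.mul_sum]
  congr 1
  refine Finset.sum_congr rfl fun y _ => Finset.sum_congr rfl fun x _ => ?_
  rw [mul_left_comm, ipSign_comm]
  rfl

end Protocol

/-! ### Hybrid argument over the blocks -/

lemma sum_prod_eq_one {Z : Type*} [Fintype Z] {w : Z → ℝ} (hw : ∑ c, w c = 1) (m : ℕ) :
    ∑ z : Fin m → Z, ∏ i, w (z i) = 1 := by
  classical
  rw [← Fintype.piFinset_univ, ← Finset.prod_univ_sum]
  simp [hw]

/-- The hybrid argument: replacing one product distribution by another changes an expectation by
at most the sum of the changes from replacing a single factor. -/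
lemma abs_sum_prod_sub_sum_prod_le {Z : Type*} [Fintype Z] {w₀ w₁ : Z → ℝ}
    (h₀ : ∀ c, 0 ≤ w₀ c) (h₁ : ∀ c, 0 ≤ w₁ c) (s₀ : ∑ c, w₀ c = 1) (s₁ : ∑ c, w₁ c = 1)
    {η : ℝ} : ∀ (m : ℕ) (F : (Fin m → Z) → ℝ),
    (∀ i z, |∑ c, (w₁ c - w₀ c) * F (Function.update z i c)| ≤ η) →
    |∑ z, (∏ i, w₁ (z i)) * F z - ∑ z, (∏ i, w₀ (z i)) * F z| ≤ m * η
  | 0, F, _ => by simp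
  | m + 1, F, hF => by
    have hsplit : ∀ w : Z → ℝ, ∑ z : Fin (m + 1) → Z, (∏ i, w (z i)) * F z =
        ∑ c, w c * ∑ z : Fin m → Z, (∏ i, w (z i)) * F (Fin.cons c z) := by
      intro w
      rw [← (Fin.consEquiv (fun _ : Fin (m + 1) => Z)).sum_comp, Fintype.sum_prod_type]
      simp [Fin.consEquiv, Fin.prod_univ_succ, Finset.mul_sum, mul_assoc]
    have ih : ∀ c, |∑ z : Fin m → Z, (∏ i, w₁ (z i)) * F (Fin.cons c z) -
        ∑ z : Fin m → Z, (∏ i, w₀ (z i)) * F (Fin.cons c z)| ≤ m * η := fun c =>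
      abs_sum_prod_sub_sum_prod_le h₀ h₁ s₀ s₁ m (fun z => F (Fin.cons c z)) fun i z => by
        simpa only [Fin.cons_update] using hF i.succ (Fin.cons c z)
    have hhead : ∀ z : Fin m → Z, |∑ c, (w₁ c - w₀ c) * F (Fin.cons c z)| ≤ η := by
      intro z
      rcases isEmpty_or_nonempty Z with hZ | ⟨⟨c₀⟩⟩
      · simp at s₀
      · simpa only [Fin.update_cons_zero] using hF 0 (Fin.cons c₀ z)
    -- The hybrid between the two products has its first factor from `w₁` and the others from `w₀`.
    have e : ∑ z : Fin (m + 1) → Z, (∏ i, w₁ (z i)) * F z -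
        ∑ z : Fin (m + 1) → Z, (∏ i, w₀ (z i)) * F z =
        ∑ c, w₁ c * (∑ z : Fin m → Z, (∏ i, w₁ (z i)) * F (Fin.cons c z) -
          ∑ z : Fin m → Z, (∏ i, w₀ (z i)) * F (Fin.cons c z)) +
        ∑ z : Fin m → Z, (∏ i, w₀ (z i)) * ∑ c, (w₁ c - w₀ c) * F (Fin.cons c z) := by
      have hc : ∑ z : Fin m → Z, (∏ i, w₀ (z i)) * ∑ c, (w₁ c - w₀ c) * F (Fin.cons c z) =
          ∑ c, (w₁ c - w₀ c) * ∑ z : Fin m → Z, (∏ i, w₀ (z i)) * F (Fin.cons c z) := by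
        simp only [Finset.mul_sum]
        rw [Finset.sum_comm]
        exact Finset.sum_congr rfl fun _ _ => Finset.sum_congr rfl fun _ _ => by ring
      rw [hc, hsplit, hsplit, ← Finset.sum_add_distrib, ← Finset.sum_sub_distrib]
      exact Finset.sum_congr rfl fun _ _ => by ring
    rw [e]
    calc _ ≤ ∑ c, w₁ c * (m * η) + ∑ z : Fin m → Z, (∏ i, w₀ (z i)) * η := by
          refine (abs_add_le _ _).trans (add_le_add ?_ ?_)
          · refine (Finset.abs_sum_le_sum_abs _ _).trans (Finset.sum_le_sum fun c _ => ?_)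
            rw [abs_mul, abs_of_nonneg (h₁ c)]
            exact mul_le_mul_of_nonneg_left (ih c) (h₁ c)
          · refine (Finset.abs_sum_le_sum_abs _ _).trans (Finset.sum_le_sum fun z _ => ?_)
            have hp : 0 ≤ ∏ i, w₀ (z i) := Finset.prod_nonneg fun i _ => h₀ _
            rw [abs_mul, abs_of_nonneg hp]
            exact mul_le_mul_of_nonneg_left (hhead z) hp
      _ = _ := by
          rw [← Finset.sum_mul, ← Finset.sum_mul, s₁, sum_prod_eq_one s₀]
          push_cast; ring

/-- The uniform distribution on the pairs of points of the cube with inner product sign `s`. -/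
noncomputable def signWeight (D : ℕ) (s : ℝ) (c : Cube D × Cube D) : ℝ :=
  (1 + s * ipSign c.1 c.2) / ∑ c : Cube D × Cube D, (1 + s * ipSign c.1 c.2)

lemma ipSign_eq_or {D : ℕ} (x y : Cube D) : ipSign x y = 1 ∨ ipSign x y = -1 := by
  have h := abs_ipSign x y
  exact eq_or_eq_neg_of_abs_eq h

lemma sum_sign {D : ℕ} (s : ℝ) : ∑ c : Cube D × Cube D, (1 + s * ipSign c.1 c.2) =
    4 ^ D + s * ∑ c : Cube D × Cube D, ipSign c.1 c.2 := by
  rw [Finset.sum_add_distrib, Finset.mul_sum]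
  simp [← mul_pow]

section

variable {D : ℕ} {η : ℝ} (hK : |∑ c : Cube D × Cube D, ipSign c.1 c.2| ≤ 4 ^ D * η)
  (hη : η ≤ 1 / 2)

include hK hη in
lemma sum_sign_pos {s : ℝ} (hs : |s| = 1) :
    0 < ∑ c : Cube D × Cube D, (1 + s * ipSign c.1 c.2) := by
  rw [sum_sign]
  have h4 : (0 : ℝ) < 4 ^ D := by positivity
  have h1 : |s * ∑ c : Cube D × Cube D, ipSign c.1 c.2| ≤ 4 ^ D * η := by
    rwa [abs_mul, hs, one_mul]
  have := (abs_le.1 h1).1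
  nlinarith

include hK hη in
lemma signWeight_nonneg {s : ℝ} (hs : |s| = 1) (c : Cube D × Cube D) :
    0 ≤ signWeight D s c := by
  refine div_nonneg ?_ (sum_sign_pos hK hη hs).le
  have : |s * ipSign c.1 c.2| = 1 := by rw [abs_mul, hs, abs_ipSign, one_mul]
  linarith [neg_abs_le (s * ipSign c.1 c.2)]

include hK hη in
lemma sum_signWeight {s : ℝ} (hs : |s| = 1) : ∑ c, signWeight D s c = 1 := by
  simp only [signWeight]
  rw [← Finset.sum_div, div_self (sum_sign_pos hK hη hs).ne']

lemma ipSign_eq_of_signWeight_ne_zero {D : ℕ} {s : ℝ} (hs : |s| = 1) {c : Cube D × Cube D}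
    (h : signWeight D s c ≠ 0) : ipSign c.1 c.2 = s := by
  by_contra hne
  refine h ?_
  have : 1 + s * ipSign c.1 c.2 = 0 := by
    rcases eq_or_eq_neg_of_abs_eq hs with rfl | rfl <;>
      rcases ipSign_eq_or c.1 c.2 with h' | h' <;> simp_all
  rw [signWeight, this, zero_div]

-- With `N = 4 ^ D`, `A = ∑ F`, and signed sums `B` of `F` and `K` of 1, the difference is `2 * (A *
-- K - B * N) / ((N - K) * (N + K))`. The numerator is at most `4 * N ^ 2 * η`, and `|K| ≤ N / 2`
-- keeps the denominator above `N ^ 2 / 2`.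
include hK hη in
lemma abs_sum_signWeight_sub_mul_le {F : Cube D × Cube D → ℝ} (hF0 : ∀ c, 0 ≤ F c)
    (hF1 : ∀ c, F c ≤ 1) (hB : |∑ c, ipSign c.1 c.2 * F c| ≤ 4 ^ D * η) :
    |∑ c, (signWeight D (-1) c - signWeight D 1 c) * F c| ≤ 8 * η := by
  have hp := sum_sign_pos hK hη (s := 1) (by simp)
  have hq := sum_sign_pos hK hη (s := -1) (by simp)
  have e : ∑ c, (signWeight D (-1) c - signWeight D 1 c) * F c =
      (∑ c, F c - ∑ c, ipSign c.1 c.2 * F c) /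
          ∑ c : Cube D × Cube D, (1 + -1 * ipSign c.1 c.2) -
        (∑ c, F c + ∑ c, ipSign c.1 c.2 * F c) /
          ∑ c : Cube D × Cube D, (1 + 1 * ipSign c.1 c.2) := by
    rw [← Finset.sum_sub_distrib, ← Finset.sum_add_distrib, Finset.sum_div, Finset.sum_div,
      ← Finset.sum_sub_distrib]
    exact Finset.sum_congr rfl fun c _ => by simp only [signWeight]; ring
  have hA0 : 0 ≤ ∑ c, F c := Finset.sum_nonneg fun c _ => hF0 c
  have hA1 : ∑ c, F c ≤ 4 ^ D := by
    refine (Finset.sum_le_sum fun c _ => hF1 c).trans (le_of_eq ?_)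
    have := sum_sign (D := D) 0
    simpa using this
  rw [e]
  rw [sum_sign] at hp hq ⊢
  rw [sum_sign]
  set A := ∑ c, F c
  set B := ∑ c, ipSign c.1 c.2 * F c
  set K := ∑ c : Cube D × Cube D, ipSign c.1 c.2
  set N : ℝ := 4 ^ D with hN
  have hN0 : 0 < N := by positivity
  have hη0 : 0 ≤ η := by
    have := (abs_nonneg _).trans hK
    exact nonneg_of_mul_nonneg_right this hN0
  have e2 : (A - B) / (N + -1 * K) - (A + B) / (N + 1 * K) =
      2 * (A * K - B * N) / ((N + -1 * K) * (N + 1 * K)) := by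
    rw [div_sub_div _ _ hq.ne' hp.ne']; congr 1; ring
  rw [e2, abs_div, abs_of_pos (mul_pos hq hp), div_le_iff₀ (mul_pos hq hp), abs_mul, abs_two]
  have h1 : |A * K - B * N| ≤ N * (N * η) + N * η * N := by
    refine (abs_sub _ _).trans (add_le_add ?_ ?_)
    · rw [abs_mul, abs_of_nonneg hA0]; gcongr
    · rw [abs_mul, abs_of_pos hN0]; gcongr
  have h2 : K ^ 2 ≤ (N / 2) ^ 2 := by
    refine sq_le_sq' ?_ ?_
    · have := (abs_le.1 hK).1; nlinarith
    · have := (abs_le.1 hK).2; nlinarith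
  have h3 : N ^ 2 / 2 ≤ (N + -1 * K) * (N + 1 * K) := by nlinarith
  nlinarith [mul_le_mul_of_nonneg_left h3 hη0]

end

/-- The concatenation of blocks of length `D`, padded to length `n`. -/
def concatBlocks {n D : ℕ} (hD : 0 < D) (u : Fin (n / D) → Cube D) (k : Fin n) : Bool :=
  if h : (k : ℕ) / D < n / D then u ⟨k / D, h⟩ ⟨k % D, Nat.mod_lt _ hD⟩ else false

lemma block_index_lt {n D : ℕ} (i : Fin (n / D)) (j : Fin D) : (i : ℕ) * D + j < n := by
  have h1 : ((i : ℕ) + 1) * D ≤ n / D * D := Nat.mul_le_mul_right D i.2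
  have h2 := Nat.div_mul_le_self n D
  have h3 := j.2
  have h4 : ((i : ℕ) + 1) * D = i * D + D := by ring
  omega

lemma concatBlocks_apply {n D : ℕ} (hD : 0 < D) (u : Fin (n / D) → Cube D) (i : Fin (n / D))
    (j : Fin D) : concatBlocks hD u ⟨i * D + j, block_index_lt i j⟩ = u i j := by
  have h1 : ((i : ℕ) * D + j) / D = i := by
    rw [mul_comm, Nat.mul_add_div hD, Nat.div_eq_of_lt j.2, add_zero]
  have h2 : ((i : ℕ) * D + j) % D = j := by
    rw [mul_comm, Nat.mul_add_mod, Nat.mod_eq_of_lt j.2]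
  simp [concatBlocks, h1, h2]

lemma neighbouring_concatBlocks {n D : ℕ} (hD : 0 < D) (u : Fin (n / D) → Cube D)
    (i : Fin (n / D)) (x : Cube D) (j : Fin D) :
    Neighbouring (concatBlocks (n := n) hD (Function.update u i x))
      (concatBlocks hD (Function.update u i (flipAt j x))) := by
  refine ⟨⟨i * D + j, block_index_lt i j⟩, fun k hk => ?_⟩
  unfold concatBlocks
  split_ifs with h
  · by_cases hi : (⟨(k : ℕ) / D, h⟩ : Fin (n / D)) = i
    · have hj : (⟨(k : ℕ) % D, Nat.mod_lt _ hD⟩ : Fin D) ≠ j := by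
        rintro rfl
        refine hk (Fin.ext ?_)
        subst hi
        simp [Nat.div_add_mod']
      rw [hi, Function.update_self, Function.update_self, flipAt, Function.update_of_ne hj]
    · rw [Function.update_of_ne hi, Function.update_of_ne hi]
  · rfl

lemma sum_filter_div_eq {n D : ℕ} (hD : 0 < D) (g : Fin n → ℕ) (i : Fin (n / D)) :
    ∑ k ∈ (Finset.univ : Finset (Fin n)).filter (fun k : Fin n => (k : ℕ) / D = i), g k =
      ∑ j : Fin D, g ⟨i * D + j, block_index_lt i j⟩ := by
  symm
  refine Finset.sum_bij (fun j _ => ⟨i * D + j, block_index_lt i j⟩) ?_ ?_ ?_ ?_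
  · intro j _
    simp [mul_comm (i : ℕ) D, Nat.mul_add_div hD, Nat.div_eq_of_lt j.2]
  · intro j _ j' _ h
    simpa [Fin.ext_iff] using h
  · intro k hk
    rw [Finset.mem_filter] at hk
    refine ⟨⟨k % D, Nat.mod_lt _ hD⟩, Finset.mem_univ _, Fin.ext ?_⟩
    simp [← hk.2, Nat.div_add_mod']
  · intro j _; rfl

lemma ipSign_eq_neg_one_pow {D : ℕ} (x y : Cube D) :
    ipSign x y = (-1) ^ ∑ j, (x j && y j).toNat := by
  rw [ipSign, ← Finset.prod_pow_eq_pow_sum]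
  refine Finset.prod_congr rfl fun j _ => ?_
  cases x j && y j <;> simp

lemma blockInnerProduct_concatBlocks {n D : ℕ} (hD : 0 < D) (u v : Fin (n / D) → Cube D) :
    blockInnerProduct n D (Fin.append (concatBlocks hD u) (concatBlocks hD v)) =
      ∑ i, (((∑ j, (u i j && v i j).toNat) % 2 : ℕ) : ℝ) := by
  rw [blockInnerProduct, Finset.sum_range]
  refine Finset.sum_congr rfl fun i _ => ?_
  rw [sum_filter_div_eq hD]
  simp only [Fin.append_left, Fin.append_right, concatBlocks_apply]

lemma blockInnerProduct_eq_zero {n D : ℕ} (hD : 0 < D) {u v : Fin (n / D) → Cube D}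
    (h : ∀ i, ipSign (u i) (v i) = 1) :
    blockInnerProduct n D (Fin.append (concatBlocks hD u) (concatBlocks hD v)) = 0 := by
  rw [blockInnerProduct_concatBlocks]
  refine Finset.sum_eq_zero fun i _ => ?_
  have h' := h i
  rw [ipSign_eq_neg_one_pow] at h'
  rcases Nat.even_or_odd (∑ j, (u i j && v i j).toNat) with h2 | h2
  · rw [Nat.even_iff.1 h2, Nat.cast_zero]
  · rw [h2.neg_one_pow] at h'; norm_num at h'

lemma blockInnerProduct_eq_card {n D : ℕ} (hD : 0 < D) {u v : Fin (n / D) → Cube D}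
    (h : ∀ i, ipSign (u i) (v i) = -1) :
    blockInnerProduct n D (Fin.append (concatBlocks hD u) (concatBlocks hD v)) =
      (n / D : ℕ) := by
  rw [blockInnerProduct_concatBlocks, Finset.sum_congr rfl (g := fun _ => (1 : ℝ))]
  · simp
  intro i _
  have h' := h i
  rw [ipSign_eq_neg_one_pow] at h'
  rcases Nat.even_or_odd (∑ j, (u i j && v i j).toNat) with h2 | h2
  · rw [h2.neg_one_pow] at h'; norm_num at h'
  · rw [Nat.odd_iff.1 h2, Nat.cast_one]

/-- An acceptance probability that is nearly independent of the inner product of each block cannot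
distinguish the value `0` of the block inner product from the maximal one. -/
lemma accept_gap_le {n D : ℕ} (hD : 0 < D) {η : ℝ} (hη : η ≤ 1 / 2)
    (hK : |∑ x : Cube D, ∑ y : Cube D, ipSign x y * 1| ≤ 4 ^ D * η)
    {F : (Fin n → Bool) → (Fin n → Bool) → ℝ} (hF0 : ∀ X Y, 0 ≤ F X Y) (hF1 : ∀ X Y, F X Y ≤ 1)
    (hF : ∀ eA eB : Cube D → Fin n → Bool, (∀ x j, Neighbouring (eA x) (eA (flipAt j x))) →
      (∀ y j, Neighbouring (eB y) (eB (flipAt j y))) →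
      |∑ x, ∑ y, ipSign x y * F (eA x) (eB y)| ≤ 4 ^ D * η)
    {p q : ℝ} (hp : ∀ X Y, blockInnerProduct n D (Fin.append X Y) = 0 → p ≤ F X Y)
    (hq : ∀ X Y, blockInnerProduct n D (Fin.append X Y) = (n / D : ℕ) → F X Y ≤ q) :
    p - q ≤ (n / D : ℕ) * (8 * η) := by
  set G : (Fin (n / D) → Cube D × Cube D) → ℝ := fun z =>
    F (concatBlocks hD fun i => (z i).1) (concatBlocks hD fun i => (z i).2) with hG
  have hK' : |∑ c : Cube D × Cube D, ipSign c.1 c.2| ≤ 4 ^ D * η := by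
    rw [Fintype.sum_prod_type]; simpa using hK
  have hone : |(1 : ℝ)| = 1 := abs_one
  have hneg : |(-1 : ℝ)| = 1 := by simp
  have h := abs_sum_prod_sub_sum_prod_le (signWeight_nonneg hK' hη hone)
    (signWeight_nonneg hK' hη hneg) (sum_signWeight hK' hη hone) (sum_signWeight hK' hη hneg)
    (η := 8 * η) (n / D) G fun i z => by
      refine abs_sum_signWeight_sub_mul_le hK' hη (fun c => hF0 _ _) (fun c => hF1 _ _) ?_
      have hb := hF (fun x => concatBlocks hD (Function.update (fun i => (z i).1) i x))
        (fun y => concatBlocks hD (Function.update (fun i => (z i).2) i y))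
        (neighbouring_concatBlocks hD _ i) (neighbouring_concatBlocks hD _ i)
      rw [Fintype.sum_prod_type]
      refine le_trans (le_of_eq ?_) hb
      congr 1
      refine Finset.sum_congr rfl fun x _ => Finset.sum_congr rfl fun y _ => ?_
      have e1 : (fun k => (Function.update z i (x, y) k).1) =
          Function.update (fun k => (z k).1) i x := by
        ext1 k; by_cases hk : k = i
        · subst hk; simp
        · simp [Function.update_of_ne hk]
      have e2 : (fun k => (Function.update z i (x, y) k).2) =
          Function.update (fun k => (z k).2) i y := by
        ext1 k; by_cases hk : k = i
        · subst hk; simp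
        · simp [Function.update_of_ne hk]
      simp only [hG, e1, e2]
  -- The two product distributions are supported on inputs where the block inner product is exactly
  -- 0, respectively maximal.
  have hsupp : ∀ {s : ℝ}, |s| = 1 → ∀ z : Fin (n / D) → Cube D × Cube D,
      ∏ i, signWeight D s (z i) ≠ 0 → ∀ i, ipSign (z i).1 (z i).2 = s := fun hs z hz i =>
    ipSign_eq_of_signWeight_ne_zero hs (Finset.prod_ne_zero_iff.1 hz i (Finset.mem_univ i))
  have h1 : p ≤ ∑ z, (∏ i, signWeight D 1 (z i)) * G z := by
    calc p = ∑ z : Fin (n / D) → Cube D × Cube D, (∏ i, signWeight D 1 (z i)) * p := by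
          rw [← Finset.sum_mul, sum_prod_eq_one (sum_signWeight hK' hη hone), one_mul]
      _ ≤ _ := by
          refine Finset.sum_le_sum fun z _ => ?_
          by_cases hz : ∏ i, signWeight D 1 (z i) = 0
          · rw [hz, zero_mul, zero_mul]
          · exact mul_le_mul_of_nonneg_left
              (hp _ _ (blockInnerProduct_eq_zero hD (hsupp hone z hz)))
              (Finset.prod_nonneg fun i _ => signWeight_nonneg hK' hη hone _)
  have h2 : ∑ z, (∏ i, signWeight D (-1) (z i)) * G z ≤ q := by
    calc _ ≤ ∑ z : Fin (n / D) → Cube D × Cube D, (∏ i, signWeight D (-1) (z i)) * q := by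
          refine Finset.sum_le_sum fun z _ => ?_
          by_cases hz : ∏ i, signWeight D (-1) (z i) = 0
          · rw [hz, zero_mul, zero_mul]
          · exact mul_le_mul_of_nonneg_left
              (hq _ _ (blockInnerProduct_eq_card hD (hsupp hneg z hz)))
              (Finset.prod_nonneg fun i _ => signWeight_nonneg hK' hη hneg _)
      _ = q := by
          rw [← Finset.sum_mul, sum_prod_eq_one (sum_signWeight hK' hη hneg), one_mul]
  linarith [(abs_le.1 h).1]

/-! ### From an accurate output to a distinguisher -/

namespace Protocol

variable {𝒳 : Type} {n : ℕ} (P : Protocol 𝒳 n)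

lemma measurable_messages (X Y : Fin n → 𝒳) (k : ℕ) :
    Measurable fun r => P.messages X Y r k := by
  induction k with
  | zero => exact measurable_const
  | succ k ih =>
    refine measurable_pi_iff.2 fun i => ?_
    simp only [messages]
    refine Fin.lastCases ?_ (fun j => ?_) i
    · simp only [Fin.snoc_last]
      split_ifs
      · exact (P.measurable_sendA k X).comp (measurable_fst.prodMk ih)
      · exact (P.measurable_sendB k Y).comp (measurable_snd.prodMk ih)
    · simp only [Fin.snoc_castSucc]
      exact (measurable_pi_apply j).comp ih

instance : IsProbabilityMeasure P.law := by
  unfold law; infer_instance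

lemma real_le_of_compl_ge {S T : Set P.Coins} (hT : MeasurableSet T) (hd : Disjoint S T)
    (hS : 0.9 ≤ P.law.real S) : P.law.real T ≤ 0.1 := by
  have h1 := measureReal_union (μ := P.law) hd hT
  have h2 : P.law.real (S ∪ T) ≤ 1 := measureReal_le_one
  linarith

lemma neighbouring_encode {D : ℕ} (enc : Fin n → Bool → 𝒳) {e : Cube D → Fin n → Bool}
    (he : ∀ x j, Neighbouring (e x) (e (flipAt j x))) (x : Cube D) (j : Fin D) :
    Neighbouring (fun k => enc k (e x k)) (fun k => enc k (e (flipAt j x) k)) := by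
  obtain ⟨i, hi⟩ := he x j
  exact ⟨i, fun k hk => congrArg (enc k) (hi k hk)⟩

/-- A two-party DP protocol cannot compute a function that encodes the block inner product with an
error below half of its range. -/
theorem not_computes_of_encodes [MeasurableSpace 𝒳] {ε δ E : ℝ} (hP : P.IsTwoPartyDP ε δ)
    (hE : Real.exp ε ≤ E) (hE1 : 1 ≤ E) {D : ℕ} (hD : 0 < D) (hn : 1 ≤ n / D)
    (hη : (n / D : ℕ) * (√(contraction (2 * E)) ^ D + 8 * D * δ) < 0.1)
    (hη0 : 0 ≤ √(contraction (2 * E)) ^ D + 8 * D * δ)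
    (enc : Fin n → Bool → 𝒳) {f : (Fin (n + n) → 𝒳) → ℝ} {κ β : ℝ}
    (hf : ∀ X Y : Fin n → Bool, f (Fin.append (fun k => enc k (X k)) (fun k => enc k (Y k))) =
      κ * blockInnerProduct n D (Fin.append X Y))
    (hβ : β < κ * (n / D : ℕ) / 2) : ¬ P.Computes f β := by
  set η := √(contraction (2 * E)) ^ D + 8 * D * δ with hηdef
  have hn' : (1 : ℝ) ≤ (n / D : ℕ) := by exact_mod_cast hn
  have hη2 : η ≤ 1 / 2 := by
    have : η ≤ (n / D : ℕ) * η := le_mul_of_one_le_left hη0 hn'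
    linarith
  -- That inner products of uniform points are nearly unbiased is read off from the privacy bound
  -- itself, with the sure event and constant encodings, for which the neighbouring conditions are
  -- trivial.
  have hK : |∑ x : Cube D, ∑ y : Cube D, ipSign x y * 1| ≤ 4 ^ D * η := by
    have := hP.abs_sum_ipSign_viewA_le P (eA := fun _ : Cube D => fun k => enc k true)
      (eB := fun _ : Cube D => fun k => enc k true) hE hE1
      (neighbouring_encode enc (e := fun _ _ => true) fun _ j => ⟨⟨0, by
        rcases Nat.eq_zero_or_pos n with h | h
        · simp [h] at hn
        · exact h⟩, fun _ _ => rfl⟩)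
      (neighbouring_encode enc (e := fun _ _ => true) fun _ j => ⟨⟨0, by
        rcases Nat.eq_zero_or_pos n with h | h
        · simp [h] at hn
        · exact h⟩, fun _ _ => rfl⟩) (T := Set.univ) MeasurableSet.univ
    simpa using this
  rintro (⟨out, hout, hc⟩ | ⟨out, hout, hc⟩)
  -- The output is compared with the middle of the range: it lies below with probability at least
  -- `0.9` at value 0 and at most `0.1` at the maximum. The gap `0.8` contradicts `8 * (n / D) * η <
  -- 0.8`.
  · have hT : MeasurableSet {v | out v ≤ κ * (n / D : ℕ) / 2} :=
      measurableSet_le hout measurable_const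
    have hview : ∀ X Y, Measurable (P.viewA X Y) := fun X Y =>
      measurable_const.prodMk (measurable_fst.prodMk (P.measurable_messages X Y _))
    have := accept_gap_le hD hη2 hK (p := 0.9) (q := 0.1)
      (F := fun X Y => P.law.real {r | P.viewA (fun k => enc k (X k)) (fun k => enc k (Y k)) r ∈
        {v | out v ≤ κ * (n / D : ℕ) / 2}})
      (fun _ _ => measureReal_nonneg) (fun _ _ => measureReal_le_one)
      (fun eA eB hA hB => hP.abs_sum_ipSign_viewA_le P hE hE1 (neighbouring_encode enc hA)
        (neighbouring_encode enc hB) hT)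
      (fun X Y h0 => by
        refine (hc (fun k => enc k (X k)) (fun k => enc k (Y k))).trans
          (measureReal_mono fun r hr => ?_)
        simp only [Set.mem_ofPred_eq, hf, h0, mul_zero, sub_zero] at hr ⊢
        linarith [le_abs_self (out (P.viewA (fun k => enc k (X k)) (fun k => enc k (Y k)) r))])
      (fun X Y h0 => by
        refine P.real_le_of_compl_ge (hview _ _ hT) ?_
          (hc (fun k => enc k (X k)) (fun k => enc k (Y k)))
        refine Set.disjoint_left.2 fun r hr hr' => ?_
        simp only [Set.mem_ofPred_eq, hf, h0] at hr hr'
        linarith [(abs_le.1 hr).1])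
    linarith
  · have hT : MeasurableSet {v | out v ≤ κ * (n / D : ℕ) / 2} :=
      measurableSet_le hout measurable_const
    have hview : ∀ X Y, Measurable (P.viewB X Y) := fun X Y =>
      measurable_const.prodMk (measurable_snd.prodMk (P.measurable_messages X Y _))
    have := accept_gap_le hD hη2 hK (p := 0.9) (q := 0.1)
      (F := fun X Y => P.law.real {r | P.viewB (fun k => enc k (X k)) (fun k => enc k (Y k)) r ∈
        {v | out v ≤ κ * (n / D : ℕ) / 2}})
      (fun _ _ => measureReal_nonneg) (fun _ _ => measureReal_le_one)
      (fun eA eB hA hB => hP.abs_sum_ipSign_viewB_le P hE hE1 (neighbouring_encode enc hA)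
        (neighbouring_encode enc hB) hT)
      (fun X Y h0 => by
        refine (hc (fun k => enc k (X k)) (fun k => enc k (Y k))).trans
          (measureReal_mono fun r hr => ?_)
        simp only [Set.mem_ofPred_eq, hf, h0, mul_zero, sub_zero] at hr ⊢
        linarith [le_abs_self (out (P.viewB (fun k => enc k (X k)) (fun k => enc k (Y k)) r))])
      (fun X Y h0 => by
        refine P.real_le_of_compl_ge (hview _ _ hT) ?_
          (hc (fun k => enc k (X k)) (fun k => enc k (Y k)))
        refine Set.disjoint_left.2 fun r hr hr' => ?_
        simp only [Set.mem_ofPred_eq, hf, h0] at hr hr'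
        linarith [(abs_le.1 hr).1])
    linarith

end Protocol

/-! ### Sensitivity and the symmetric function -/

/-- The number of blocks of length `D` containing an odd number of the points marked by `g`. -/
noncomputable def blockParity (n D : ℕ) (g : Fin n → Bool) : ℝ :=
  ∑ i ∈ Finset.range (n / D),
    (((∑ k ∈ (Finset.univ : Finset (Fin n)).filter (fun k : Fin n => (k : ℕ) / D = i),
      (g k).toNat) % 2 : ℕ) : ℝ)

lemma blockInnerProduct_eq_blockParity (n D : ℕ) (w : Fin (n + n) → Bool) :
    blockInnerProduct n D w =
      blockParity n D fun k => w (Fin.castAdd n k) && w (Fin.natAdd n k) := rfl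

lemma blockParity_false (n D : ℕ) : blockParity n D (fun _ => false) = 0 := by
  simp [blockParity]

/-- Only blocks meeting `S` can change, and each contributes at most 1. -/
lemma abs_blockParity_sub_le {n D : ℕ} {g g' : Fin n → Bool} (S : Finset (Fin n))
    (h : ∀ k, k ∉ S → g k = g' k) : |blockParity n D g - blockParity n D g'| ≤ S.card := by
  rw [blockParity, blockParity, ← Finset.sum_sub_distrib]
  refine (Finset.abs_sum_le_sum_abs _ _).trans ?_
  calc _ ≤ ∑ i ∈ Finset.range (n / D),
        (if i ∈ S.image (fun k : Fin n => (k : ℕ) / D) then (1 : ℝ) else 0) := by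
        refine Finset.sum_le_sum fun i _ => ?_
        split_ifs with hi
        · have h2 : ∀ a : ℕ, ((a % 2 : ℕ) : ℝ) ∈ Set.Icc (0 : ℝ) 1 := fun a =>
            ⟨Nat.cast_nonneg _, by exact_mod_cast Nat.lt_succ_iff.1 (Nat.mod_lt a two_pos)⟩
          exact abs_sub_le_of_nonneg_of_le (h2 _).1 (h2 _).2 (h2 _).1 (h2 _).2
        · rw [Finset.sum_congr rfl fun k hk => ?_, sub_self, abs_zero]
          rw [h k fun hkS => hi (Finset.mem_image.2 ⟨k, hkS, (Finset.mem_filter.1 hk).2⟩)]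
    _ ≤ ((S.image (fun k : Fin n => (k : ℕ) / D)).card : ℝ) := by
        rw [← Finset.sum_filter, Finset.sum_const, nsmul_eq_mul, mul_one]
        exact_mod_cast Finset.card_le_card fun i hi => (Finset.mem_filter.1 hi).2
    _ ≤ _ := by exact_mod_cast Finset.card_image_le

lemma blockParity_update {n D : ℕ} {g : Fin n → Bool} (a : Fin n) (ha : (a : ℕ) / D < n / D)
    (h : ∀ k : Fin n, (k : ℕ) / D = a / D → g k = false) :
    blockParity n D (Function.update g a true) = blockParity n D g + 1 := by
  rw [← sub_eq_iff_eq_add', blockParity, blockParity, ← Finset.sum_sub_distrib,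
    Finset.sum_eq_single ((a : ℕ) / D)]
  · rw [Finset.sum_eq_single a, Finset.sum_eq_zero]
    · simp
    · intro k hk
      rw [h k (Finset.mem_filter.1 hk).2, Bool.toNat_false]
    · intro k hk hka
      rw [Function.update_of_ne hka, h k (Finset.mem_filter.1 hk).2, Bool.toNat_false]
    · intro ha'
      simp at ha'
  · intro i _ hi
    rw [Finset.sum_congr rfl fun k hk => ?_, sub_self]
    rw [Function.update_of_ne]
    rintro rfl
    exact hi (Finset.mem_filter.1 hk).2.symm
  · intro h'
    exact absurd (Finset.mem_range.2 ha) h'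

lemma hasSensitivity_blockInnerProduct {n D : ℕ} (hn : 1 ≤ n / D) :
    HasSensitivity (blockInnerProduct n D) 1 := by
  have hn0 : 0 < n := by
    rcases Nat.eq_zero_or_pos n with h | h
    · simp [h] at hn
    · exact h
  refine IsGreatest.isLUB ⟨?_, ?_⟩
  · set a : Fin n := ⟨0, hn0⟩ with ha
    refine ⟨Fin.append (Function.update (fun _ => false) a true)
      (Function.update (fun _ => false) a true),
      Fin.append (Function.update (fun _ => false) a true) (fun _ => false),
      ⟨Fin.natAdd n a, fun j hj => ?_⟩, ?_⟩
    · induction j using Fin.addCases with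
      | left k => simp only [Fin.append_left]
      | right k =>
        have : k ≠ a := fun h => hj (by rw [h])
        simp only [Fin.append_right, Function.update_of_ne this]
    · simp only [blockInnerProduct_eq_blockParity, Fin.append_left, Fin.append_right, Bool.and_self,
        Bool.and_false]
      rw [blockParity_update a (by simp only [ha, Nat.zero_div]; omega) (fun _ _ => rfl), blockParity_false]
      simp
  · rintro _ ⟨w, w', ⟨t, ht⟩, rfl⟩
    simp only [blockInnerProduct_eq_blockParity]
    obtain ⟨a, ha⟩ : ∃ a : Fin n, t = Fin.castAdd n a ∨ t = Fin.natAdd n a := by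
      induction t using Fin.addCases with
      | left a => exact ⟨a, Or.inl rfl⟩
      | right a => exact ⟨a, Or.inr rfl⟩
    refine (abs_blockParity_sub_le {a} fun k hk => ?_).trans (by simp)
    rw [Finset.mem_singleton] at hk
    have hk' : (k : ℕ) ≠ a := fun h => hk (Fin.ext h)
    rw [ht, ht]
    · rcases ha with rfl | rfl <;> simp [Fin.ext_iff] <;> omega
    · rcases ha with rfl | rfl <;> simp [Fin.ext_iff] <;> omega

/-- The element of the domain `[2 n]` that encodes the bit `b` at position `k`. -/
def encodeBit {n : ℕ} (k : Fin n) (b : Bool) : Fin (2 * n) :=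
  ⟨2 * k + b.toNat, by have := k.2; have := Bool.toNat_lt b; omega⟩

lemma encodeBit_inj {n : ℕ} {k k' : Fin n} {b b' : Bool} :
    encodeBit k b = encodeBit k' b' ↔ k = k' ∧ b = b' := by
  refine ⟨fun h => ?_, fun h => by rw [h.1, h.2]⟩
  have h' : 2 * (k : ℕ) + b.toNat = 2 * k' + b'.toNat := congrArg Fin.val h
  cases b <;> cases b' <;> simp [Fin.ext_iff] at h' ⊢ <;> omega

/-- The number of occurrences of `c` in `w`. -/
def occurrences {n N : ℕ} (w : Fin N → Fin (2 * n)) (c : Fin (2 * n)) : ℕ :=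
  ((Finset.univ : Finset (Fin N)).filter fun t => w t = c).card

/-- Half the block parity of the set of positions whose bit `1` occurs exactly twice. -/
noncomputable def symmetricParity (n D : ℕ) (w : Fin (n + n) → Fin (2 * n)) : ℝ :=
  1 / 2 * blockParity n D fun k => decide (occurrences w (encodeBit k true) = 2)

lemma isSymmetric_symmetricParity (n D : ℕ) : IsSymmetric (symmetricParity n D) := by
  intro σ w
  have h : ∀ c, occurrences (w ∘ σ) c = occurrences w c := fun c =>
    Finset.card_equiv σ (by simp)
  simp only [symmetricParity, h]

lemma symmetricParity_encode (n D : ℕ) (X Y : Fin n → Bool) :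
    symmetricParity n D (Fin.append (fun k => encodeBit k (X k)) (fun k => encodeBit k (Y k))) =
      1 / 2 * blockInnerProduct n D (Fin.append X Y) := by
  rw [symmetricParity, blockInnerProduct_eq_blockParity]
  congr 2
  ext1 k
  have h : ∀ Z : Fin n → Bool, (∑ t, if encodeBit t (Z t) = encodeBit k true then 1 else 0) =
      (Z k).toNat := by
    intro Z
    rw [Finset.sum_eq_single k]
    · cases h : Z k <;> simp [encodeBit_inj]
    · intro t _ ht
      simp [encodeBit_inj, ht]
    · simp
  rw [occurrences, Finset.card_filter, Fin.sum_univ_add]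
  simp only [Fin.append_left, Fin.append_right, h]
  cases X k <;> cases Y k <;> rfl

lemma occurrences_extend {n N : ℕ} (hN : 4 ≤ N) (v : Fin 4 → Fin (2 * n)) {c d : Fin (2 * n)}
    (hcd : d ≠ c) :
    occurrences (fun t : Fin N => if h : (t : ℕ) < 4 then v ⟨t, h⟩ else d) c =
      (if v 0 = c then 1 else 0) + (if v 1 = c then 1 else 0) + (if v 2 = c then 1 else 0) +
        (if v 3 = c then 1 else 0) := by
  obtain ⟨r, rfl⟩ := Nat.exists_eq_add_of_le hN
  rw [occurrences, Finset.card_filter, Fin.sum_univ_add, Fin.sum_univ_four]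
  simp [hcd]

lemma hasSensitivity_symmetricParity {n D : ℕ} (hD : 0 < D) (hn : 2 ≤ n / D) :
    HasSensitivity (symmetricParity n D) 1 := by
  have hDn : 2 * D ≤ n := (Nat.le_div_iff_mul_le hD).1 hn
  refine IsGreatest.isLUB ⟨?_, ?_⟩
  · set a : Fin n := ⟨0, by omega⟩ with ha
    set b : Fin n := ⟨D, by omega⟩ with hb
    have hab : a ≠ b := fun h => hD.ne (congrArg Fin.val h)
    set w : (Fin 4 → Fin (2 * n)) → Fin (n + n) → Fin (2 * n) := fun v t =>
      if h : (t : ℕ) < 4 then v ⟨t, h⟩ else encodeBit a false with hw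
    -- Sensitivity 1 is attained by destroying two pairs at once: with `c` the symbol of `b`, both
    -- symbols occur twice; with `c` that of `a`, they occur three times and once. The positions `0`
    -- and `D` lie in different blocks, so the parity sum drops by 2. This is why two blocks are
    -- required.
    set v : Fin (2 * n) → Fin 4 → Fin (2 * n) := fun c =>
      ![c, encodeBit a true, encodeBit a true, encodeBit b true] with hv
    have hocc : ∀ c k, occurrences (w (v c)) (encodeBit k true) =
        (if c = encodeBit k true then 1 else 0) + (if a = k then 1 else 0) +
          (if a = k then 1 else 0) + (if b = k then 1 else 0) := by
      intro c k
      rw [hw, occurrences_extend (by omega) _ (by simp [encodeBit_inj])]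
      simp [hv, encodeBit_inj]
    refine ⟨w (v (encodeBit b true)), w (v (encodeBit a true)), ⟨⟨0, by omega⟩, fun j hj => ?_⟩, ?_⟩
    · have hj0 : (j : ℕ) ≠ 0 := fun h => hj (Fin.ext h)
      simp only [hw]
      split_ifs with h
      · obtain ⟨s, hs⟩ : ∃ s : Fin 3, (⟨j, h⟩ : Fin 4) = s.succ :=
          ⟨⟨j - 1, by omega⟩, by ext; simp; omega⟩
        rw [hs]
        simp [hv]
      · rfl
    · have h1 : (fun k => decide (occurrences (w (v (encodeBit b true))) (encodeBit k true) = 2)) =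
          Function.update (Function.update (fun _ => false) a true) b true := by
        ext1 k
        rw [hocc]
        by_cases hka : k = a
        · subst hka; simp [encodeBit_inj, hab, hab.symm]
        · by_cases hkb : k = b
          · subst hkb; simp [hab]
          · simp [encodeBit_inj, hka, hkb, Ne.symm hka, Ne.symm hkb]
      have h2 : (fun k => decide (occurrences (w (v (encodeBit a true))) (encodeBit k true) = 2)) =
          fun _ => false := by
        ext1 k
        rw [hocc]
        by_cases hka : k = a
        · subst hka; simp [hab.symm]
        · by_cases hkb : k = b
          · subst hkb; simp [encodeBit_inj, hab]
          · simp [encodeBit_inj, Ne.symm hka, Ne.symm hkb]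
      have hb1 : (b : ℕ) / D = 1 := by simp [hb, Nat.div_self hD]
      rw [symmetricParity, symmetricParity, h1, h2, blockParity_update b (by omega) ?_,
        blockParity_update a (by simp [ha]; omega) (fun _ _ => rfl), blockParity_false]
      · norm_num
      · intro k hk
        rw [hb1] at hk
        refine Function.update_of_ne ?_ _ _
        rintro rfl
        simp [ha] at hk
  · rintro _ ⟨w, w', ⟨t, ht⟩, rfl⟩
    -- Replacing a symbol affects only the counts of the old and of the new symbol, hence at most
    -- two positions.
    set S : Finset (Fin n) := Finset.univ.filter (fun k => encodeBit k true = w t) ∪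
      Finset.univ.filter (fun k => encodeBit k true = w' t) with hS
    have hcard : ∀ c : Fin (2 * n),
        (Finset.univ.filter (fun k : Fin n => encodeBit k true = c)).card ≤ 1 := by
      intro c
      refine Finset.card_le_one.2 fun k hk k' hk' => ?_
      rw [Finset.mem_filter] at hk hk'
      exact (encodeBit_inj.1 (hk.2.trans hk'.2.symm)).1
    have hS2 : S.card ≤ 2 := (Finset.card_union_le _ _).trans (add_le_add (hcard _) (hcard _))
    have h := abs_blockParity_sub_le (D := D)
      (g := fun k => decide (occurrences w (encodeBit k true) = 2))
      (g' := fun k => decide (occurrences w' (encodeBit k true) = 2)) S fun k hk => by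
        have hk1 : encodeBit k true ≠ w t := fun h => hk (by simp [hS, h])
        have hk2 : encodeBit k true ≠ w' t := fun h => hk (by simp [hS, h])
        have : occurrences w (encodeBit k true) = occurrences w' (encodeBit k true) := by
          rw [occurrences, occurrences]
          congr 1
          refine Finset.filter_congr fun s _ => ?_
          by_cases hs : s = t
          · subst hs; simp [hk1.symm, hk2.symm]
          · rw [ht s hs]
        rw [this]
    rw [symmetricParity, symmetricParity, ← mul_sub, abs_mul, abs_of_pos (by norm_num)]
    have : (S.card : ℝ) ≤ 2 := by exact_mod_cast hS2
    linarith

/-! ### Choice of the block length and the constants -/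

/-- A logarithmic block length for which the total leakage of all blocks is below `0.1`. -/
lemma exists_block_length {θ : ℝ} (hθ0 : 0 ≤ θ) (hθ1 : θ < 1) :
    ∃ c₁ : ℝ, 0 < c₁ ∧ ∃ c₂ : ℝ, 0 < c₂ ∧ ∃ N : ℕ, ∀ n : ℕ, N ≤ n →
      ∃ D : ℕ, 0 < D ∧ 2 ≤ n / D ∧
        (∀ δ : ℝ, 0 ≤ δ → δ ≤ c₁ / n → (n / D : ℕ) * (θ ^ D + 8 * D * δ) < 0.1) ∧
        c₂ * (n / Real.log n) < 1 / 2 * (n / D : ℕ) / 2 := by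
  -- The maximum keeps the logarithm meaningful when `θ = 0`.
  set t := max θ (1 / 2) with ht
  have ht0 : 0 < t := lt_of_lt_of_le (by norm_num) (le_max_right _ _)
  have ht1 : t < 1 := max_lt hθ1 (by norm_num)
  have hL : 0 < -Real.log t := by linarith [Real.log_neg ht0 ht1]
  -- Chosen so that `t ^ (C * log n) = n ^ (-2)`; the bias summed over at most `n` blocks is then at
  -- most `1 / n`.
  set C := 2 / -Real.log t with hC
  have hC0 : 0 < C := div_pos two_pos hL
  have hev : ∀ᶠ n : ℕ in Filter.atTop,
      ‖Real.log (n : ℝ)‖ ≤ 1 / (2 * (C + 1)) * ‖(n : ℝ)‖ :=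
    tendsto_natCast_atTop_atTop.eventually
      (Real.isLittleO_log_id_atTop.def (c := 1 / (2 * (C + 1))) (by positivity))
  obtain ⟨N, hN⟩ := Filter.eventually_atTop.1 hev
  -- The leakage is at most `1 / 21` from the bias plus `8 / 200` from `δ`, in total below `0.1`.
  refine ⟨1 / 200, by norm_num, 1 / (16 * (C + 1)), by positivity, max N 21, fun n hn => ?_⟩
  have hn21 : 21 ≤ n := (le_max_right _ _).trans hn
  have hn21' : (21 : ℝ) ≤ n := by exact_mod_cast hn21
  have hn0 : (0 : ℝ) < n := by linarith
  have hlog : 1 ≤ Real.log n := by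
    rw [Real.le_log_iff_exp_le hn0]
    linarith [Real.exp_one_lt_d9]
  have hlogn : 2 * (C + 1) * Real.log n ≤ n := by
    have h := hN n ((le_max_left _ _).trans hn)
    rw [Real.norm_of_nonneg (by linarith), Real.norm_of_nonneg hn0.le, one_div_mul_eq_div,
      le_div_iff₀ (by positivity)] at h
    linarith
  set D := ⌈C * Real.log n⌉₊ with hD
  have hD0 : 0 < D := Nat.ceil_pos.2 (by positivity)
  have hDlow : C * Real.log n ≤ D := Nat.le_ceil _
  have hDup : (D : ℝ) ≤ (C + 1) * Real.log n := by
    have := (Nat.ceil_lt_add_one (a := C * Real.log n) (by positivity)).le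
    linarith
  have hm2 : 2 ≤ n / D := by
    rw [Nat.le_div_iff_mul_le hD0]
    have : (2 * D : ℝ) ≤ n := by linarith
    exact_mod_cast this
  have hmD : ((n / D : ℕ) : ℝ) * D ≤ n := by exact_mod_cast Nat.div_mul_le_self n D
  have hD1 : (1 : ℝ) ≤ D := by exact_mod_cast hD0
  have hm2' : (2 : ℝ) ≤ (n / D : ℕ) := by exact_mod_cast hm2
  have hmn : ((n / D : ℕ) : ℝ) ≤ n := by nlinarith
  refine ⟨D, hD0, hm2, fun δ hδ0 hδ => ?_, ?_⟩
  · have hpow : θ ^ D ≤ 1 / (n : ℝ) ^ 2 := by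
      calc θ ^ D ≤ t ^ D := pow_le_pow_left₀ hθ0 (le_max_left _ _) D
        _ = Real.exp (-(D * -Real.log t)) := by
            rw [mul_neg, neg_neg, Real.exp_nat_mul, Real.exp_log ht0]
        _ ≤ Real.exp (-(2 * Real.log n)) := by
            refine Real.exp_le_exp.2 (neg_le_neg ?_)
            calc 2 * Real.log n = C * Real.log n * -Real.log t := by
                  rw [hC, mul_right_comm, div_mul_cancel₀ _ hL.ne']
              _ ≤ _ := mul_le_mul_of_nonneg_right hDlow hL.le
        _ = _ := by
            rw [Real.exp_neg, two_mul, Real.exp_add, Real.exp_log hn0, one_div, sq]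
    have h1 : ((n / D : ℕ) : ℝ) * θ ^ D ≤ 1 / 21 := by
      calc ((n / D : ℕ) : ℝ) * θ ^ D ≤ n * (1 / (n : ℝ) ^ 2) :=
            mul_le_mul hmn hpow (by positivity) hn0.le
        _ = 1 / n := by field_simp
        _ ≤ 1 / 21 := one_div_le_one_div_of_le (by norm_num) hn21'
    have h2 : ((n / D : ℕ) : ℝ) * D * δ ≤ 1 / 200 := by
      calc ((n / D : ℕ) : ℝ) * D * δ ≤ n * (1 / 200 / n) := mul_le_mul hmD hδ hδ0 hn0.le
        _ = 1 / 200 := by field_simp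
    have e : ((n / D : ℕ) : ℝ) * (θ ^ D + 8 * D * δ) =
        (n / D : ℕ) * θ ^ D + 8 * ((n / D : ℕ) * D * δ) := by ring
    rw [e]
    norm_num at h1 h2 ⊢
    linarith
  -- Rounding costs at most a factor 2, so `n / log n < 2 * (C + 1) * (n / D)`. The factor `1 / (16
  -- * (C + 1))` then gives less than `(n / D) / 8`, below half of the range even of the halved
  -- function.
  · have hlt : (n : ℝ) < D * ((n / D : ℕ) + 1) := by
      exact_mod_cast Nat.lt_mul_div_succ n hD0
    have h3 : (n : ℝ) < 2 * ((C + 1) * Real.log n) * (n / D : ℕ) := by nlinarith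
    rw [div_mul_div_comm, one_mul, div_lt_iff₀ (by positivity)]
    nlinarith

end TwoPartyDP
theorem theorem10 (ε₀ : ℝ) (hε₀ : 0 ≤ ε₀) :
    (∃ c₁ : ℝ, 0 < c₁ ∧ ∃ c₂ : ℝ, 0 < c₂ ∧ ∃ N : ℕ, ∀ n : ℕ, N ≤ n →
      ∃ f : (Fin (n + n) → Bool) → ℝ,
        (∃ D : ℕ, 1 ≤ D ∧ f = TwoPartyDP.blockInnerProduct n D) ∧
        TwoPartyDP.HasSensitivity f 1 ∧
        ∀ ε δ β : ℝ, 0 ≤ ε → ε ≤ ε₀ → 0 ≤ δ → δ ≤ c₁ / n → β ≤ c₂ * (n / Real.log n) →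
          ∀ P : TwoPartyDP.Protocol Bool n, P.IsTwoPartyDP ε δ → ¬ P.Computes f β) ∧
    (∃ c₁ : ℝ, 0 < c₁ ∧ ∃ c₂ : ℝ, 0 < c₂ ∧ ∃ N : ℕ, ∀ n : ℕ, N ≤ n →
      ∃ f : (Fin (n + n) → Fin (2 * n)) → ℝ,
        TwoPartyDP.IsSymmetric f ∧
        TwoPartyDP.HasSensitivity f 1 ∧
        ∀ ε δ β : ℝ, 0 ≤ ε → ε ≤ ε₀ → 0 ≤ δ → δ ≤ c₁ / n → β ≤ c₂ * (n / Real.log n) →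
          ∀ P : TwoPartyDP.Protocol (Fin (2 * n)) n,
            P.IsTwoPartyDP ε δ → ¬ P.Computes f β) := by

  have hE1 : 1 ≤ Real.exp ε₀ := Real.one_le_exp hε₀
  have hG : (1 : ℝ) ≤ 2 * Real.exp ε₀ := by linarith
  have hθ0 : 0 ≤ √(TwoPartyDP.contraction (2 * Real.exp ε₀)) := Real.sqrt_nonneg _
  have hθ1 : √(TwoPartyDP.contraction (2 * Real.exp ε₀)) < 1 := by
    rw [Real.sqrt_lt' one_pos, one_pow]
    exact TwoPartyDP.contraction_lt_one hG
  obtain ⟨c₁, hc₁, c₂, hc₂, N, hN⟩ := TwoPartyDP.exists_block_length hθ0 hθ1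
  refine ⟨⟨c₁, hc₁, c₂, hc₂, N, fun n hn => ?_⟩, ⟨c₁, hc₁, c₂, hc₂, N, fun n hn => ?_⟩⟩
  all_goals obtain ⟨D, hD, hm, hη, hβ⟩ := hN n hn
  · refine ⟨TwoPartyDP.blockInnerProduct n D, ⟨D, hD, rfl⟩,
      TwoPartyDP.hasSensitivity_blockInnerProduct (by omega), ?_⟩
    intro ε δ β _ hε hδ0 hδ hβ' P hP
    refine P.not_computes_of_encodes hP (Real.exp_le_exp.2 hε) hE1 hD (by omega) (hη δ hδ0 hδ)
      (by positivity) (fun _ b => b) (κ := 1) (fun X Y => (one_mul _).symm) ?_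
    have : (0 : ℝ) ≤ (n / D : ℕ) := Nat.cast_nonneg _
    linarith
  · refine ⟨TwoPartyDP.symmetricParity n D, TwoPartyDP.isSymmetric_symmetricParity n D,
      TwoPartyDP.hasSensitivity_symmetricParity hD hm, ?_⟩
    intro ε δ β _ hε hδ0 hδ hβ' P hP
    exact P.not_computes_of_encodes hP (Real.exp_le_exp.2 hε) hE1 hD (by omega) (hη δ hδ0 hδ)
      (by positivity) TwoPartyDP.encodeBit (TwoPartyDP.symmetricParity_encode n D)
      (hβ'.trans_lt hβ)
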